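/- **Theorem (Explicit nearest-neighbour recurrence coefficients for the Jacobi–Piñeiro polynomials with $p$ weights).** *Setting.* Let $p\in\mathbb N$ and let $\alpha_1,\dots,\alpha_p,\beta>-1$ be real with $\alpha_i-\alpha_j\notin\mathbb Z$ for $i\ne j$. Consider on $[0,1]$ the weights $w_i(x)=x^{\alpha_i}$ and the measure $d\mu(x)=(1-x)^\beta dx$. For $\vec n=(n_1,\dots,n_p)\in\mathbb N_0^p$ put $|\vec n|=n_1+\cdots+n_p$; $\vec e_k$ is the $k$-th unit vector and $(x)_m=x(x+1)\cdots(x+m-1)$, $(x)_0=1$. A monic polynomial $B$ with $\deg B\le|\vec n|$ is of *type II* for $\vec n$ if $\int_0^1x^jB(x)x^{\alpha_i}(1-x)^\beta dx=0$ for $1\le i\le p$, $0\le j\le n_i-1$. A vector $(A^{(1)},\dots,A^{(p)})$ of polynomials with $\deg A^{(i)}\le n_i-1$ ($A^{(i)}=0$ if $n_i=0$) is of *type I* for $\vec n$ if $\sum_{i=1}^p\int_0^1x^jA^{(i)}(x)x^{\alpha_i}(1-x)^\beta dx$ equals $0$ for $0\le j\le|\vec n|-2$ and $1$ for $j=|\vec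 n|-1$. *Explicit polynomials.* For every $\vec n\in\mathbb N_0^p$ there is exactly one type II polynomial $B_{\vec n}$ and exactly one type I vector $(A^{(i)}_{\vec n})_{i}$, namely $$A^{(i)}_{\vec n}(x)=\sum_{l=0}^{n_i-1}\frac{(-1)^{|\vec n|-1}\prod_{q\ne i}(\alpha_q+\beta+|\vec n|)_{n_q}}{(n_i-1)!\prod_{q\neq i}(\alpha_q-\alpha_i)_{n_q}}\,\frac{\Gamma(\alpha_i+\beta+|\vec n|+n_i)}{\Gamma(\beta+|\vec n|)\Gamma(\alpha_i+1)}\,\frac{(-n_i+1)_l(\alpha_i+\beta+|\vec n|)_l}{l!\,(\alpha_i+1)_l}\prod_{q\neq i}\frac{(\alpha_i-\alpha_q-n_q+1)_l}{(\alpha_i-\alpha_q+1)_l}\;x^l,$$ $$B_{\vec n}(x)=\sum_{l_1=0}^{n_1}\cdots\sum_{l_p=0}^{n_p}(-1)^{|\vec n|}\prod_{q=1}^p\left[\frac{(\alpha_q+1)_{n_q}}{(\alpha_q+\beta+|\vec n|+1)_{n_q}}\frac{(-n_q)_{l_q}}{l_q!}\,(\alpha_q+\beta+N_q+1+L_{q+1})_{l_q}\,\frac{(\alpha_q+n_q+1)_{L_{q+1}}}{(\alpha_q+1)_{L_q}}\right]x^{l_1+\cdots+l_p},$$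 where $N_q=n_1+\cdots+n_q$, $L_q=l_q+\cdots+l_p$, $L_{p+1}=0$. *Closed forms.* For $1\le k\le p$ let $$b^0_{\vec n}(k)=\frac{\alpha_k+n_k+1}{\alpha_k+\beta+n_k+|\vec n|+2}\prod_{q=1}^p\frac{\alpha_k-\alpha_q+n_k+1}{\alpha_k-\alpha_q+n_k+1-n_q}+\sum_{i=1}^p\frac{(\alpha_i+n_i)(\alpha_k+\beta+n_k+|\vec n|+1)}{(\alpha_i+\beta+n_i+|\vec n|)_2(\alpha_i-\alpha_k-n_k+n_i-1)}\frac{\prod_{q=1}^p(\alpha_i-\alpha_q+n_i)}{\prod_{q\ne i}(\alpha_i-\alpha_q+n_i-n_q)}.$$ For a permutation $\pi$ of $\{1,\dots,p\}$ put $\vec s_j=\vec e_{\pi(1)}+\cdots+\vec e_{\pi(j)}$ ($\vec s_0=\vec 0$), $S(\pi,j)=\{i: j\le\pi^{-1}(i)\}$, $S^{\mathsf c}(\pi,j)=\{1,\dots,p\}\setminus S(\pi,j)$, and for $1\le j\le p$ $$F^j_{\vec n}(\pi;\beta)=(\beta+|\vec n|-j+1)_j\prod_{q=1}^p\frac{(\alpha_q+\beta+|\vec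 n|-j+1)_j}{(\alpha_q+\beta+|\vec n|-j+n_q+1)_j}\sum_{i\in S(\pi,j)}\frac{\alpha_i+n_i}{(\alpha_i+\beta+n_i+|\vec n|-j)_{j+2}}\,\frac{\prod_{q=1}^p(\alpha_i-\alpha_q+n_i)}{\prod_{q\in S(\pi,j),\,q\ne i}(\alpha_i-\alpha_q+n_i-n_q)\prod_{q\in S^{\mathsf c}(\pi,j)}(\alpha_q+\beta+|\vec n|-j+n_q)}.$$ In these sums the terms with $n_i=0$, whose numerator contains the factor $n_i$, are read as $0$. *Conclusion.* There are real numbers $b^j_{\vec n}=b^j_{\vec n}(\pi)$ such that the following hold. 1. Whenever $1\le j\le p$, $\vec n-\vec s_{j-1}\in\mathbb N_0^p$ and $|\vec n|\ge j$: $b^j_{\vec n}(\pi)=F^j_{\vec n}(\pi;\beta)$, provided that $|\vec n|>j$ or $\alpha_q+\beta\neq-1$ for all $q$; and in every case $b^j_{\vec n}(\pi)=\lim_{\beta'\to\beta,\ \beta'\ne\beta}F^j_{\vec n}(\pi;\beta')$ (so the closed form is read by continuity where it is $0/0$). 2. (Type II) For all $\pi$, $k$ and all $\vec n\in\mathbb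 N_0^p$ in which no zero entry precedes a nonzero one in the order $n_{\pi(1)},\dots,n_{\pi(p)}$ (in particular if all $n_i\ge1$), $$xB_{\vec n}(x)=B_{\vec n+\vec e_k}(x)+b^0_{\vec n}(k)B_{\vec n}(x)+\sum_{j=1}^pb^j_{\vec n}B_{\vec n-\vec s_j}(x),$$ where terms in which $\vec n-\vec s_j$ has a negative entry are $0$. 3. (Type I) For all $\pi$, $k$ and all $\vec n\in\mathbb N_0^p$ with $n_k\ge1$, and all $i\in\{1,\dots,p\}$, $$xA^{(i)}_{\vec n}(x)=A^{(i)}_{\vec n-\vec e_k}(x)+b^0_{\vec n-\vec e_k}(k)A^{(i)}_{\vec n}(x)+\sum_{j=1}^pb^j_{\vec n+\vec s_{j-1}}A^{(i)}_{\vec n+\vec s_j}(x).$$ -/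

import Mathlib

namespace JacobiPineiro

open Polynomial

/-- The Pochhammer symbol `(x)_m = x (x + 1) ⋯ (x + m - 1)`, with `(x)_0 = 1`. -/
noncomputable def poch (x : ℝ) (m : ℕ) : ℝ := (ascPochhammer ℝ m).eval x

/-- The length `|n| = n_1 + ⋯ + n_p` of a multi-index. -/
def len {p : ℕ} (n : Fin p → ℕ) : ℕ := ∑ i, n i

/-- The multi-index `s_j = e_{π(1)} + ⋯ + e_{π(j)}` (with `s_0 = 0`); indices are counted from `0`
in `Fin p`, so the sum runs over the `m : Fin p` with `m < j`. -/
def stepIndex {p : ℕ} (π : Equiv.Perm (Fin p)) (j : ℕ) : Fin p → ℕ :=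
  ∑ m ∈ Finset.univ.filter (fun m : Fin p => (m : ℕ) < j), Pi.single (π m) 1

/-- The set `S(π, j) = {i : j ≤ π⁻¹(i)}`, with `j` and `π⁻¹(i)` counted from `1`. -/
def indexSet {p : ℕ} (π : Equiv.Perm (Fin p)) (j : ℕ) : Finset (Fin p) :=
  Finset.univ.filter (fun i => j ≤ (π.symm i : ℕ) + 1)

/-- `∫_0^1 f(x) x^a (1 - x)^β dx` for a polynomial `f`. -/
noncomputable def weightedIntegral (a β : ℝ) (f : ℝ[X]) : ℝ :=
  ∫ x in (0 : ℝ)..1, f.eval x * (x ^ a * (1 - x) ^ β)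

/-- `B` is a monic multiple orthogonal polynomial of type II of multi-index `n` for the weights
`x ^ α_i` and the measure `(1 - x) ^ β dx` on `[0, 1]`. -/
def IsTypeII {p : ℕ} (α : Fin p → ℝ) (β : ℝ) (n : Fin p → ℕ) (B : ℝ[X]) : Prop :=
  B.Monic ∧ B.natDegree ≤ len n ∧
    ∀ i : Fin p, ∀ j : ℕ, j < n i → weightedIntegral (α i) β (X ^ j * B) = 0

/-- `A = (A_1, …, A_p)` is a vector of multiple orthogonal polynomials of type I of multi-index `n`
for the weights `x ^ α_i` and the measure `(1 - x) ^ β dx` on `[0, 1]`.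
Here `degree A_i < n_i` says that `deg A_i ≤ n_i - 1`, and that `A_i = 0` if `n_i = 0`. -/
def IsTypeI {p : ℕ} (α : Fin p → ℝ) (β : ℝ) (n : Fin p → ℕ) (A : Fin p → ℝ[X]) : Prop :=
  (∀ i, (A i).degree < (n i : WithBot ℕ)) ∧
    ∀ j : ℕ, j < len n →
      ∑ i, weightedIntegral (α i) β (X ^ j * A i) = if j + 1 = len n then 1 else 0

/-- The coefficient `C_n^{(i), l}` of `x ^ l` in the type I Jacobi–Piñeiro polynomial
(used for `l < n i` only). The two factors `Γ(α_i + β + |n|)` and `(α_i + β + |n|)_{n_i}` are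
written as their product `Γ(α_i + β + |n| + n_i)`, which has no pole. -/
noncomputable def typeICoeff {p : ℕ} (α : Fin p → ℝ) (β : ℝ) (n : Fin p → ℕ) (i : Fin p) (l : ℕ) :
    ℝ :=
  (-1) ^ (len n - 1) *
    ((∏ q ∈ Finset.univ.erase i, poch (α q + β + len n) (n q)) /
      ((Nat.factorial (n i - 1) : ℝ) * ∏ q ∈ Finset.univ.erase i, poch (α q - α i) (n q))) *
    (Real.Gamma (α i + β + len n + n i) / (Real.Gamma (β + len n) * Real.Gamma (α i + 1))) *
    ((poch (-(n i : ℝ) + 1) l * poch (α i + β + len n) l) /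
      ((Nat.factorial l : ℝ) * poch (α i + 1) l)) *
    ∏ q ∈ Finset.univ.erase i, poch (α i - α q - n q + 1) l / poch (α i - α q + 1) l

/-- The type I Jacobi–Piñeiro polynomials `∑_{l < n_i} C_n^{(i), l} x ^ l`, `i = 1, …, p`. -/
noncomputable def typeI {p : ℕ} (α : Fin p → ℝ) (β : ℝ) (n : Fin p → ℕ) : Fin p → ℝ[X] :=
  fun i => ∑ l ∈ Finset.range (n i), C (typeICoeff α β n i l) * X ^ l

/-- The coefficient `C_n^{l_1, …, l_p}` of the type II Jacobi–Piñeiro polynomial. With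
`N_q = n_1 + ⋯ + n_q` and `L_q = l_q + ⋯ + l_p` (`L_{p+1} = 0`), the quotient
`(α_q + β + N_q + 1)_{L_q} / (α_q + β + N_q + 1)_{L_{q+1}}` is written as
`(α_q + β + N_q + 1 + L_{q+1})_{l_q}`, which has no denominator. -/
noncomputable def typeIICoeff {p : ℕ} (α : Fin p → ℝ) (β : ℝ) (n l : Fin p → ℕ) : ℝ :=
  (-1) ^ len n *
    ∏ q : Fin p,
      (poch (α q + 1) (n q) / poch (α q + β + len n + 1) (n q)) *
      (poch (-(n q : ℝ)) (l q) / (Nat.factorial (l q) : ℝ)) *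
      poch (α q + β + (∑ r ∈ Finset.Iic q, n r : ℕ) + 1 + (∑ r ∈ Finset.Ioi q, l r : ℕ)) (l q) *
      (poch (α q + n q + 1) (∑ r ∈ Finset.Ioi q, l r) / poch (α q + 1) (∑ r ∈ Finset.Ici q, l r))

/-- The monic type II Jacobi–Piñeiro polynomial
`∑_{l_1 ≤ n_1} ⋯ ∑_{l_p ≤ n_p} C_n^{l_1, …, l_p} x ^ (l_1 + ⋯ + l_p)`. -/
noncomputable def typeII {p : ℕ} (α : Fin p → ℝ) (β : ℝ) (n : Fin p → ℕ) : ℝ[X] :=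
  ∑ l ∈ Fintype.piFinset (fun q => Finset.range (n q + 1)),
    C (typeIICoeff α β n l) * X ^ (∑ q, l q)

open Classical in
/-- The polynomial `B_{n - s}`, read as `0` if `n - s` has a negative entry. -/
noncomputable def typeIISub {p : ℕ} (α : Fin p → ℝ) (β : ℝ) (n s : Fin p → ℕ) : ℝ[X] :=
  if s ≤ n then typeII α β (n - s) else 0

/-- The closed form of the recurrence coefficient `b_n^0(k)`. -/
noncomputable def coeffZero {p : ℕ} (α : Fin p → ℝ) (β : ℝ) (n : Fin p → ℕ) (k : Fin p) : ℝ :=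
  (α k + n k + 1) / (α k + β + n k + len n + 2) *
      ∏ q, (α k - α q + n k + 1) / (α k - α q + n k + 1 - n q) +
    ∑ i, ((α i + n i) * (α k + β + n k + len n + 1)) /
        (poch (α i + β + n i + len n) 2 * (α i - α k - n k + n i - 1)) *
      ((∏ q, (α i - α q + n i)) / ∏ q ∈ Finset.univ.erase i, (α i - α q + n i - n q))

/-- The closed form of the recurrence coefficient `b_n^j`, `1 ≤ j ≤ p`, for the permutation `π`. -/
noncomputable def coeffPos {p : ℕ} (α : Fin p → ℝ) (β : ℝ) (π : Equiv.Perm (Fin p))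
    (n : Fin p → ℕ) (j : ℕ) : ℝ :=
  poch (β + len n - j + 1) j *
    (∏ q, poch (α q + β + len n - j + 1) j / poch (α q + β + len n - j + n q + 1) j) *
    ∑ i ∈ indexSet π j,
      (α i + n i) / poch (α i + β + n i + len n - j) (j + 2) *
        ((∏ q, (α i - α q + n i)) /
          ((∏ q ∈ (indexSet π j).erase i, (α i - α q + n i - n q)) *
            ∏ q ∈ (indexSet π j)ᶜ, (α q + β + len n - j + n q)))

end JacobiPineiro

namespace JacobiPineiro

open Polynomial Finset

/-! ### The Pochhammer symbol -/

/-! For `deg f ≤ N`, the integral of `x^s f(x) (1-x)^β` is `Γ(s+1)Γ(β+1)/Γ(s+β+N+2)` times a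
polynomial in `s` of degree at most `N` (`mellinPart`). The value of this polynomial at `s = -β-N-1`
gives the coefficient of `x^N` in `f`. Since `x^j w_i` only shifts the exponent, every orthogonality
condition concerns values at the nodes `α_i + l`, `l < n_i`.

For the explicit type II sum, iterating the Pfaff–Saalschütz formula turns this polynomial into a
constant times `∏ (α_q - s)_{n_q}` (`mellinPart_typeII`), whose zeros are exactly the nodes. The
type I coefficients are, up to the inverse Gamma quotient, the values at `-β-|n|` of the Lagrange
basis polynomials on the nodes (`typeICoeff_eq`). So pairing with the type I vector interpolates the
Mellin polynomial at the point that reveals the top coefficient (`typeIForm_eq_coeff`). Type I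
orthogonality, both uniqueness statements and biorthogonality follow.

The recurrences are expansions along a chain of multi-indices, with coefficients obtained by pairing
`x B_n` with type I vectors (`typeII_recurrence`, `typeI_recurrence`). In such a pairing nearly all
nodes contribute zero: one per `i` can survive, plus one extra node for `b^0`. Evaluating these
gives the closed forms (`typeIForm_add_single`, `typeIForm_X_mul_typeII`). The singularities of
`F^j` in `β` come from a factor that cancels, whence the limit statement (`closedForm`). -/

@[simp] lemma poch_zero (x : ℝ) : poch x 0 = 1 := by simp [poch]

lemma poch_succ (x : ℝ) (m : ℕ) : poch x (m + 1) = poch x m * (x + m) := by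
  simp [poch, ascPochhammer_succ_eval]

@[simp] lemma poch_one (x : ℝ) : poch x 1 = x := by simp [poch]

lemma poch_eq_prod (x : ℝ) (m : ℕ) : poch x m = ∏ j ∈ range m, (x + j) := by
  induction m with
  | zero => simp
  | succ m ih => rw [poch_succ, prod_range_succ, ih]

lemma poch_add (x : ℝ) (m n : ℕ) : poch x (m + n) = poch x m * poch (x + m) n := by
  simp only [poch_eq_prod, prod_range_add, Nat.cast_add, add_assoc]

lemma poch_succ_left (x : ℝ) (m : ℕ) : poch x (m + 1) = x * poch (x + 1) m := by
  rw [add_comm, poch_add]; simp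

lemma poch_pos {x : ℝ} (hx : 0 < x) (m : ℕ) : 0 < poch x m := ascPochhammer_pos m x hx

lemma poch_ne_zero {x : ℝ} {m : ℕ} (h : ∀ j < m, x + j ≠ 0) : poch x m ≠ 0 := by
  rw [poch_eq_prod]
  exact prod_ne_zero_iff.2 fun j hj => h j (mem_range.1 hj)

lemma poch_eq_zero {x : ℝ} {m j : ℕ} (hj : j < m) (h : x + j = 0) : poch x m = 0 := by
  rw [poch_eq_prod]
  exact prod_eq_zero (mem_range.2 hj) h

lemma poch_neg (x : ℝ) (m : ℕ) : poch (-x) m = (-1) ^ m * poch (x - m + 1) m := by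
  rw [poch_eq_prod, poch_eq_prod, ← prod_range_reflect]
  conv_rhs => rw [← card_range m, ← prod_const, card_range, ← prod_mul_distrib]
  refine prod_congr rfl fun j hj => ?_
  have : j + 1 ≤ m := mem_range.1 hj
  rw [show m - 1 - j = m - (j + 1) by omega, Nat.cast_sub this]
  push_cast
  ring

lemma Gamma_add_nat {x : ℝ} (hx : 0 < x) (m : ℕ) :
    Real.Gamma (x + m) = poch x m * Real.Gamma x := by
  induction m with
  | zero => simp
  | succ m ih =>
    rw [Nat.cast_succ, ← add_assoc, Real.Gamma_add_one (by positivity), ih, poch_succ]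
    ring

lemma continuous_poch (m : ℕ) : Continuous fun x : ℝ => poch x m :=
  (ascPochhammer ℝ m).continuous

/-! ### Integrals against a beta weight -/

lemma intervalIntegrable_weight {a β : ℝ} (ha : -1 < a) (hβ : -1 < β) :
    IntervalIntegrable (fun x : ℝ => x ^ a * (1 - x) ^ β) MeasureTheory.volume 0 1 := by
  have h := Complex.betaIntegral_convergent (u := (a + 1 : ℝ)) (v := (β + 1 : ℝ))
    (by simpa using by linarith) (by simpa using by linarith)
  rw [intervalIntegrable_iff_integrableOn_Ioc_of_le zero_le_one] at h ⊢
  refine (MeasureTheory.Integrable.re h).congr ?_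
  refine (MeasureTheory.ae_restrict_iff' measurableSet_Ioc).2 (Filter.Eventually.of_forall ?_)
  intro x hx
  have h1 : (x : ℂ) ^ (((a + 1 : ℝ) : ℂ) - 1) = ((x ^ a : ℝ) : ℂ) := by
    rw [Complex.ofReal_cpow hx.1.le]; push_cast; ring_nf
  have h2 : (1 - (x : ℂ)) ^ (((β + 1 : ℝ) : ℂ) - 1) = (((1 - x) ^ β : ℝ) : ℂ) := by
    rw [Complex.ofReal_cpow (by linarith [hx.2])]; push_cast; ring_nf
  simp only [h1, h2]
  rw [← Complex.ofReal_mul]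
  simp

lemma integral_weight {a β : ℝ} (ha : -1 < a) (hβ : -1 < β) :
    ∫ x in (0 : ℝ)..1, x ^ a * (1 - x) ^ β =
      Real.Gamma (a + 1) * Real.Gamma (β + 1) / Real.Gamma (a + β + 2) := by
  have h := Complex.betaIntegral_eq_Gamma_mul_div ((a + 1 : ℝ) : ℂ) ((β + 1 : ℝ) : ℂ)
    (by simpa using by linarith) (by simpa using by linarith)
  rw [← Complex.ofReal_add, Complex.Gamma_ofReal, Complex.Gamma_ofReal, Complex.Gamma_ofReal,
    Complex.betaIntegral] at h
  rw [show a + β + 2 = a + 1 + (β + 1) by ring]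
  apply Complex.ofReal_injective
  rw [← intervalIntegral.integral_ofReal]
  push_cast at h ⊢
  rw [← h]
  refine intervalIntegral.integral_congr fun x hx => ?_
  rw [Set.uIcc_of_le zero_le_one] at hx
  rw [Complex.ofReal_cpow hx.1, Complex.ofReal_cpow (by linarith [hx.2])]
  push_cast
  ring_nf

lemma intervalIntegrable_polynomial_weight {a β : ℝ} (ha : -1 < a) (hβ : -1 < β) (f : ℝ[X]) :
    IntervalIntegrable (fun x : ℝ => f.eval x * (x ^ a * (1 - x) ^ β))
      MeasureTheory.volume 0 1 :=
  (intervalIntegrable_weight ha hβ).continuousOn_mul f.continuous.continuousOn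

/-- The weighted integral as a linear functional on polynomials. -/
noncomputable def weightedIntegralₗ {a β : ℝ} (ha : -1 < a) (hβ : -1 < β) : ℝ[X] →ₗ[ℝ] ℝ where
  toFun f := weightedIntegral a β f
  map_add' f g := by
    simp only [weightedIntegral, eval_add, add_mul]
    exact intervalIntegral.integral_add (intervalIntegrable_polynomial_weight ha hβ f)
      (intervalIntegrable_polynomial_weight ha hβ g)
  map_smul' c f := by
    simp only [weightedIntegral, eval_smul, smul_eq_mul, mul_assoc, RingHom.id_apply]
    exact intervalIntegral.integral_const_mul _ _

lemma weightedIntegralₗ_apply {a β : ℝ} (ha : -1 < a) (hβ : -1 < β) (f : ℝ[X]) :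
    weightedIntegralₗ ha hβ f = weightedIntegral a β f := rfl

/-- Splitting `x ^ (a + j)` requires `x > 0`, so the comparison is made on `(0, 1]`. -/
lemma weightedIntegral_X_pow_mul {a β : ℝ} (j : ℕ) (f : ℝ[X]) :
    weightedIntegral a β (X ^ j * f) = weightedIntegral (a + j) β f := by
  unfold weightedIntegral
  rw [intervalIntegral.integral_of_le zero_le_one, intervalIntegral.integral_of_le zero_le_one]
  refine MeasureTheory.setIntegral_congr_fun measurableSet_Ioc fun x hx => ?_
  simp only [eval_mul, eval_pow, eval_X]
  rw [Real.rpow_add hx.1, Real.rpow_natCast]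
  ring

/-- The polynomial part `∑_{l ≤ N} f_l (s + 1)_l (s + β + 2 + l)_{N - l}` of the Mellin transform
of `f(x) (1 - x) ^ β` for a polynomial `f` of degree at most `N`. -/
noncomputable def mellinPart (β : ℝ) (N : ℕ) (f : ℝ[X]) (s : ℝ) : ℝ :=
  ∑ l ∈ range (N + 1), f.coeff l * (poch (s + 1) l * poch (s + β + 2 + l) (N - l))

/-- Each monomial gives a beta integral; over the common denominator `Γ(a+β+N+2)` the Gamma
quotients become Pochhammer symbols. -/
lemma weightedIntegral_eq_mellinPart {a β : ℝ} (ha : -1 < a) (hβ : -1 < β) {N : ℕ} {f : ℝ[X]}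
    (hf : f.natDegree ≤ N) :
    weightedIntegral a β f =
      Real.Gamma (a + 1) * Real.Gamma (β + 1) / Real.Gamma (a + β + N + 2) *
        mellinPart β N f a := by
  rw [← weightedIntegralₗ_apply ha hβ, mellinPart, mul_sum]
  conv_lhs => rw [f.as_sum_range_C_mul_X_pow' (Nat.lt_succ_of_le hf)]
  rw [map_sum]
  refine sum_congr rfl fun l hl => ?_
  have hl : l ≤ N := Nat.lt_succ_iff.1 (mem_range.1 hl)
  have hal : -1 < a + l := lt_of_lt_of_le ha (by simp)
  have key : weightedIntegral a β (X ^ l) =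
      Real.Gamma (a + l + 1) * Real.Gamma (β + 1) / Real.Gamma (a + l + β + 2) := by
    rw [← integral_weight hal hβ, ← mul_one (X ^ l), weightedIntegral_X_pow_mul]
    simp [weightedIntegral]
  rw [← smul_eq_C_mul, map_smul, weightedIntegralₗ_apply, key, smul_eq_mul,
    show a + l + 1 = a + 1 + l by ring, Gamma_add_nat (by linarith) l,
    show a + β + N + 2 = (a + l + β + 2) + (N - l : ℕ) by rw [Nat.cast_sub hl]; ring,
    Gamma_add_nat (by linarith) (N - l), show a + β + 2 + l = a + l + β + 2 by ring]
  have h1 := (Real.Gamma_pos_of_pos (show 0 < a + l + β + 2 by linarith)).ne'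
  have h2 := (poch_pos (show 0 < a + l + β + 2 by linarith) (N - l)).ne'
  field_simp

/-! ### The Mellin transform of the type II polynomials -/

/-- The Pfaff–Saalschütz sum, with denominators cleared. -/
lemma saalschutz (n : ℕ) {a : ℝ} (ha : -1 < a) (β s : ℝ) :
    ∑ l ∈ range (n + 1), poch (-(n : ℝ)) l / (l.factorial : ℝ) * poch (a + β + n + 1) l /
        poch (a + 1) l * (poch (s + 1) l * poch (s + β + 2 + l) (n - l)) =
      poch (β + 1) n * poch (a - s) n / poch (a + 1) n := by
  induction n generalizing β with
  | zero => simp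
  | succ n ih =>
    have han : (a + 1 + n : ℝ) ≠ 0 := by
      have : (0 : ℝ) ≤ n := n.cast_nonneg
      linarith
    -- The induction lowers `n` and raises `β` by one, which leaves the parameter `a + β + n + 1` of
    -- the sum unchanged.
    set c : ℕ → ℝ := fun l => poch (-(n : ℝ)) l / (l.factorial : ℝ) *
      poch (a + (β + 1) + n + 1) l / poch (a + 1) l with hc
    set E : ℕ → ℝ := fun l => poch (s + 1) l * poch (s + β + 2 + l) (n + 1 - l) with hE
    -- Contiguous relation: each coefficient for `n + 1` combines two neighbouring coefficients for
    -- `n`, which prepares a summation by parts.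
    have hrec : ∀ l, (a + 1 + n) * (poch (-((n + 1 : ℕ) : ℝ)) (l + 1) / ((l + 1).factorial : ℝ) *
        poch (a + β + (n + 1 : ℕ) + 1) (l + 1) / poch (a + 1) (l + 1)) =
        (a + 1 + n + (l + 1 : ℕ)) * c (l + 1) - (a + β + n + 2 + l) * c l := by
      intro l
      have h1 : poch (-((n + 1 : ℕ) : ℝ)) (l + 1) = -(n + 1) * poch (-(n : ℝ)) l := by
        rw [poch_succ_left]; push_cast; ring_nf
      have h2 := (poch_pos (show 0 < a + 1 by linarith) l).ne'
      have h3 : (l.factorial : ℝ) ≠ 0 := by positivity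
      have h4 : (a + 1 + l : ℝ) ≠ 0 := by
        have : (0 : ℝ) ≤ l := l.cast_nonneg
        linarith
      simp only [hc]
      rw [h1, poch_succ (a + 1), poch_succ (-(n : ℝ)), poch_succ _ l, poch_succ _ l,
        Nat.factorial_succ,
        show a + β + ((n + 1 : ℕ) : ℝ) + 1 = a + (β + 1) + n + 1 by push_cast; ring]
      push_cast
      field_simp
      ring
    have hlast : c (n + 1) = 0 := by
      simp only [hc]
      rw [poch_eq_zero (Nat.lt_succ_self n) (by ring)]
      simp
    have hE1 : ∀ l ∈ range (n + 1), E l = (s + β + 2 + l) *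
        (poch (s + 1) l * poch (s + (β + 1) + 2 + l) (n - l)) := by
      intro l hl
      have : l ≤ n := Nat.lt_succ_iff.1 (mem_range.1 hl)
      simp only [hE]
      rw [Nat.sub_add_comm this, poch_succ_left]
      ring_nf
    have hE2 : ∀ l ∈ range (n + 1), E (l + 1) = (s + 1 + l) *
        (poch (s + 1) l * poch (s + (β + 1) + 2 + l) (n - l)) := by
      intro l hl
      simp only [hE]
      rw [poch_succ, Nat.add_sub_add_right]
      push_cast
      ring_nf
    have hsum : (a + 1 + n) * ∑ l ∈ range (n + 1 + 1), poch (-((n + 1 : ℕ) : ℝ)) l /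
        (l.factorial : ℝ) * poch (a + β + (n + 1 : ℕ) + 1) l / poch (a + 1) l * E l =
        (β + 1) * (a + n - s) * ∑ l ∈ range (n + 1),
          c l * (poch (s + 1) l * poch (s + (β + 1) + 2 + l) (n - l)) := by
      -- Index shift; the upper boundary term vanishes because `c (n + 1) = 0`.
      have hsplit : ∑ l ∈ range (n + 1), (a + 1 + n + l) * c l * E l =
          ∑ l ∈ range (n + 1), (a + 1 + n + (l + 1 : ℕ)) * c (l + 1) * E (l + 1) +
            (a + 1 + n) * E 0 := by
        have h := sum_range_succ' (fun l : ℕ => (a + 1 + n + l) * c l * E l) (n + 1)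
        rw [sum_range_succ, hlast] at h
        simpa [hc] using h
      rw [sum_range_succ', mul_add, mul_sum]
      have : ∀ l ∈ range (n + 1), (a + 1 + n) * (poch (-((n + 1 : ℕ) : ℝ)) (l + 1) /
          ((l + 1).factorial : ℝ) * poch (a + β + (n + 1 : ℕ) + 1) (l + 1) /
          poch (a + 1) (l + 1) * E (l + 1)) =
          (a + 1 + n + (l + 1 : ℕ)) * c (l + 1) * E (l + 1) -
            (a + β + n + 2 + l) * c l * E (l + 1) := by
        intro l _
        rw [← mul_assoc, hrec]; ring
      rw [sum_congr rfl this, sum_sub_distrib]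
      simp only [poch_zero, Nat.factorial_zero, Nat.cast_one, div_one, one_mul]
      rw [sub_add_eq_add_sub, ← hsplit, ← sum_sub_distrib, mul_sum]
      -- The factor `(a+1+n+l)(s+β+2+l) - (a+β+n+2+l)(s+1+l)` equals `(β+1)(a+n-s)`, independent of
      -- `l`.
      refine sum_congr rfl fun l hl => ?_
      rw [hE1 l hl, hE2 l hl]
      ring
    rw [ih (β + 1)] at hsum
    apply mul_left_cancel₀ han
    rw [hsum, poch_succ_left (β + 1), poch_succ (a - s), poch_succ (a + 1)]
    have h2 := (poch_pos (show 0 < a + 1 by linarith) n).ne'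
    field_simp
    ring

/-! ### Reduction of the multiple sum to Pfaff–Saalschütz -/

lemma sum_Ici_eq {p : ℕ} (l : Fin p → ℕ) (q : Fin p) :
    ∑ r ∈ Ici q, l r = l q + ∑ r ∈ Ioi q, l r := by
  rw [Ici_eq_cons_Ioi, sum_cons]

lemma sum_Iic_succ {p : ℕ} (n : Fin (p + 1) → ℕ) (q : Fin p) :
    ∑ r ∈ Iic q.succ, n r = n 0 + ∑ r ∈ Iic q, n r.succ := by
  have h : ∀ {k : ℕ} (f : Fin k → ℕ) (i : Fin k),
      ∑ r ∈ Iic i, f r = ∑ r, if r ≤ i then f r else 0 := by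
    intro k f i
    rw [← sum_filter]
    congr 1
    ext r
    simp
  rw [h, h, Fin.sum_univ_succ]
  simp [Fin.succ_le_succ_iff]

lemma sum_piFinset_succ {p : ℕ} (S : Fin (p + 1) → Finset ℕ) (f : (Fin (p + 1) → ℕ) → ℝ) :
    ∑ l ∈ Fintype.piFinset S, f l =
      ∑ l ∈ Fintype.piFinset (fun q : Fin p => S q.succ), ∑ a ∈ S 0, f (Fin.cons a l) := by
  rw [sum_comm, ← sum_product']
  refine sum_nbij' (fun l => (l 0, Fin.tail l)) (fun x => Fin.cons x.1 x.2) ?_ ?_ ?_ ?_ ?_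
  · intro l hl
    simp only [Fintype.mem_piFinset, mem_product] at hl ⊢
    exact ⟨hl 0, fun q => hl q.succ⟩
  · intro x hx
    simp only [Fintype.mem_piFinset, mem_product] at hx ⊢
    exact Fin.cases hx.1 fun q => by simpa using hx.2 q
  · intro l _; simp
  · intro x _; simp
  · intro l _; simp

/-- The factor of index `q` in the coefficients of the type II polynomials, up to constants. -/
noncomputable def typeIIFactor {p : ℕ} (α : Fin p → ℝ) (β : ℝ) (n l : Fin p → ℕ) (q : Fin p) : ℝ :=
  (poch (-(n q : ℝ)) (l q) / (Nat.factorial (l q) : ℝ)) *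
      poch (α q + β + (∑ r ∈ Finset.Iic q, n r : ℕ) + 1 + (∑ r ∈ Finset.Ioi q, l r : ℕ)) (l q) *
      (poch (α q + n q + 1) (∑ r ∈ Finset.Ioi q, l r) / poch (α q + 1) (∑ r ∈ Finset.Ici q, l r))

/-- Induction on `p`. With the tail fixed, the sum over the first index is a Saalschütz sum; what
remains is the same multiple sum for the tail with `β` replaced by `β + n 0`. -/
lemma sum_typeIIFactor {p : ℕ} (α : Fin p → ℝ) (hα : ∀ i, -1 < α i) (β s : ℝ) (n : Fin p → ℕ) :
    ∑ l ∈ Fintype.piFinset (fun q => range (n q + 1)), (∏ q, typeIIFactor α β n l q) *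
        (poch (s + 1) (∑ q, l q) * poch (s + β + 2 + (∑ q, l q : ℕ)) (len n - ∑ q, l q)) =
      poch (β + 1) (len n) * ∏ q, poch (α q - s) (n q) / poch (α q + 1) (n q) := by
  induction p generalizing β with
  | zero => simp [len]
  | succ p ih =>
    have hlen : len n = n 0 + len (fun q : Fin p => n q.succ) := by simp [len, Fin.sum_univ_succ]
    have ih' := ih (fun q => α q.succ) (fun q => hα q.succ) (β + n 0) (fun q => n q.succ)
    rw [sum_piFinset_succ, hlen, poch_add, Fin.prod_univ_succ,
      show β + 1 + n 0 = β + n 0 + 1 by ring]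
    have : ∀ x y z w : ℝ, x * y * (z * w) = x * z * (y * w) := fun x y z w => by ring
    rw [this, ← ih', mul_sum]
    refine sum_congr rfl fun l hl => ?_
    have hL : ∑ q, l q ≤ len fun q : Fin p => n q.succ := sum_le_sum fun q _ => by
      have := Fintype.mem_piFinset.1 hl q
      exact Nat.lt_succ_iff.1 (mem_range.1 this)
    set L := ∑ q, l q with hLdef
    set N := len fun q : Fin p => n q.succ
    have hfac : ∀ (a : ℕ) (q : Fin p), typeIIFactor α β n (Fin.cons a l) q.succ =
        typeIIFactor (fun q => α q.succ) (β + n 0) (fun q => n q.succ) l q := by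
      intro a q
      simp only [typeIIFactor, sum_Ici_eq, sum_Iic_succ, Fin.cons_succ, Fin.sum_Ioi_succ]
      push_cast
      ring_nf
    have h0 : 0 < α 0 + 1 + L := by
      have : (0 : ℝ) ≤ L := L.cast_nonneg
      linarith [hα 0]
    -- The tail sum `L` shifts both `α 0` and `s`, so the difference `α 0 - s` in the result does
    -- not see it.
    have hs := saalschutz (n 0) (a := α 0 + L) (by linarith) β (s + L)
    -- The remaining dependence on `L` cancels: both groupings of `(α_0 + 1)_{L + n_0}` agree.
    have hp : poch (α 0 + n 0 + 1) L / (poch (α 0 + 1) L * poch (α 0 + L + 1) (n 0)) =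
        1 / poch (α 0 + 1) (n 0) := by
      have h1 := poch_add (α 0 + 1) L (n 0)
      have h2 := poch_add (α 0 + 1) (n 0) L
      have h3 := (poch_pos (show 0 < α 0 + 1 by linarith [hα 0]) L).ne'
      have h4 := (poch_pos (show 0 < α 0 + 1 by linarith [hα 0]) (n 0)).ne'
      have h5 := (poch_pos (show 0 < α 0 + L + 1 by linarith [hα 0]) (n 0)).ne'
      rw [add_comm L, h2, add_right_comm, add_right_comm _ _ (L : ℝ)] at h1
      rw [div_eq_div_iff (mul_ne_zero h3 h5) h4]
      linarith
    calc _ = ∑ a ∈ range (n 0 + 1),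
          (∏ q, typeIIFactor (fun q => α q.succ) (β + n 0) (fun q => n q.succ) l q) *
          (poch (s + 1) L * poch (s + (β + n 0) + 2 + L) (N - L)) *
          (poch (α 0 + n 0 + 1) L / poch (α 0 + 1) L) *
          (poch (-(n 0 : ℝ)) a / (a.factorial : ℝ) * poch (α 0 + L + β + n 0 + 1) a /
            poch (α 0 + L + 1) a *
            (poch (s + L + 1) a * poch (s + L + β + 2 + a) (n 0 - a))) := by
          refine sum_congr rfl fun a ha => ?_
          have ha : a ≤ n 0 := Nat.lt_succ_iff.1 (mem_range.1 ha)
          rw [Fin.prod_univ_succ, prod_congr rfl fun q _ => hfac a q]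
          have e1 : ∑ q, (Fin.cons a l : Fin (p + 1) → ℕ) q = L + a := by
            rw [Fin.sum_univ_succ]; simp [hLdef, add_comm]
          have e2 : typeIIFactor α β n (Fin.cons a l) 0 =
              poch (-(n 0 : ℝ)) a / (a.factorial : ℝ) * poch (α 0 + L + β + n 0 + 1) a *
              (poch (α 0 + n 0 + 1) L / (poch (α 0 + 1) L * poch (α 0 + L + 1) a)) := by
            have : Iic (0 : Fin (p + 1)) = {0} := by ext; simp
            simp only [typeIIFactor, sum_Ici_eq, Fin.sum_Ioi_zero, Fin.cons_succ, Fin.cons_zero,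
              this, sum_singleton, ← hLdef]
            rw [add_comm a L, poch_add]
            ring_nf
          have e3 : n 0 + N - (L + a) = (n 0 - a) + (N - L) := by omega
          rw [e1, e2, e3, poch_add, poch_add, Nat.cast_add, Nat.cast_sub ha]
          ring_nf
      _ = _ := by
          rw [← mul_sum, hs]
          calc _ = (∏ q, typeIIFactor (fun q => α q.succ) (β + n 0) (fun q => n q.succ) l q) *
              (poch (s + 1) L * poch (s + (β + n 0) + 2 + L) (N - L)) * poch (β + 1) (n 0) *
              poch (α 0 - s) (n 0) *
              (poch (α 0 + n 0 + 1) L / (poch (α 0 + 1) L * poch (α 0 + L + 1) (n 0))) := by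
                rw [show α 0 + L - (s + L) = α 0 - s by ring]
                ring
            _ = _ := by rw [hp]; ring

/-! ### The polynomial part of the Mellin transform -/

lemma mellinPart_C_mul_X_pow (β c : ℝ) {N k : ℕ} (hk : k ≤ N) (s : ℝ) :
    mellinPart β N (C c * X ^ k) s = c * (poch (s + 1) k * poch (s + β + 2 + k) (N - k)) := by
  rw [mellinPart, sum_eq_single k]
  · simp
  · intro l _ hl
    simp [coeff_X_pow, hl]
  · intro h
    exact absurd (mem_range.2 (Nat.lt_succ_of_le hk)) h

lemma mellinPart_sum {ι : Type*} (β : ℝ) (N : ℕ) (t : Finset ι) (f : ι → ℝ[X]) (s : ℝ) :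
    mellinPart β N (∑ i ∈ t, f i) s = ∑ i ∈ t, mellinPart β N (f i) s := by
  simp only [mellinPart, finsetSum_coeff, sum_mul]
  rw [sum_comm]

/-- Evaluating the Mellin transform at `-β - N - 1` picks out the coefficient of degree `N`. -/
lemma mellinPart_eval (β : ℝ) (N : ℕ) (f : ℝ[X]) :
    mellinPart β N f (-β - N - 1) = f.coeff N * ((-1) ^ N * poch (β + 1) N) := by
  rw [mellinPart, sum_eq_single N]
  · rw [show -β - N - 1 + 1 = -(β + N) by ring, poch_neg]
    simp
  · intro l hl hlN
    have hl : l < N := lt_of_le_of_ne (Nat.lt_succ_iff.1 (mem_range.1 hl)) hlN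
    -- The base is `-(N - l - 1)`, so the last of the `N - l` factors is zero.
    rw [poch_eq_zero (x := -β - N - 1 + β + 2 + l) (j := N - l - 1) (by omega)]
    · simp
    · rw [Nat.sub_sub, Nat.cast_sub (by omega)]; push_cast; ring
  · simp

/-- The degree bound is what makes Lagrange interpolation on `N + 1` nodes exact. -/
lemma exists_mellinPoly (β : ℝ) (N : ℕ) (f : ℝ[X]) :
    ∃ P : ℝ[X], P.natDegree ≤ N ∧ ∀ s, P.eval s = mellinPart β N f s := by
  refine ⟨∑ l ∈ range (N + 1), C (f.coeff l) * ((ascPochhammer ℝ l).comp (X + C 1) *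
    (ascPochhammer ℝ (N - l)).comp (X + C (β + 2 + l))), ?_, ?_⟩
  · refine natDegree_sum_le_of_forall_le _ _ fun l hl => ?_
    have hl : l ≤ N := Nat.lt_succ_iff.1 (mem_range.1 hl)
    refine (natDegree_C_mul_le _ _).trans (natDegree_mul_le.trans ?_)
    simp only [natDegree_comp, ascPochhammer_natDegree, natDegree_X_add_C]
    omega
  · intro s
    simp only [eval_finsetSum, eval_mul, eval_C, eval_comp, eval_add, eval_X, mellinPart, poch]
    refine sum_congr rfl fun l _ => ?_
    ring_nf

/-! ### The type II polynomials -/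

lemma le_len {p : ℕ} (n : Fin p → ℕ) (i : Fin p) : n i ≤ len n :=
  single_le_sum (f := n) (fun _ _ => Nat.zero_le _) (mem_univ i)

/-- The base can be nonpositive only for `n = 0`, where the product is empty; if `n q > 0`, then
`len n ≥ 1` makes it positive. -/
lemma poch_add_len_pos {p : ℕ} {α : Fin p → ℝ} {β : ℝ} (hα : ∀ i, -1 < α i) (hβ : -1 < β)
    (n : Fin p → ℕ) (q : Fin p) : 0 < poch (α q + β + len n + 1) (n q) := by
  rcases Nat.eq_zero_or_pos (n q) with h | h
  · simp [h]
  · have : (1 : ℝ) ≤ len n := by exact_mod_cast h.trans_le (le_len n q)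
    exact poch_pos (by linarith [hα q]) _

lemma sum_le_len {p : ℕ} {n l : Fin p → ℕ}
    (hl : l ∈ Fintype.piFinset (fun q => range (n q + 1))) : ∑ q, l q ≤ len n :=
  sum_le_sum fun q _ => Nat.lt_succ_iff.1 (mem_range.1 (Fintype.mem_piFinset.1 hl q))

lemma typeII_natDegree_le {p : ℕ} (α : Fin p → ℝ) (β : ℝ) (n : Fin p → ℕ) :
    (typeII α β n).natDegree ≤ len n :=
  natDegree_sum_le_of_forall_le _ _ fun _ hl =>
    (natDegree_C_mul_X_pow_le _ _).trans (sum_le_len hl)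

/-- This factorization carries everything about `typeII`: the zeros in `s` give orthogonality, and
the value at `-β - len n - 1` gives monicity. -/
lemma mellinPart_typeII {p : ℕ} {α : Fin p → ℝ} (hα : ∀ i, -1 < α i) (β : ℝ)
    (n : Fin p → ℕ) (s : ℝ) :
    mellinPart β (len n) (typeII α β n) s = (-1) ^ len n * poch (β + 1) (len n) *
      ∏ q, poch (α q - s) (n q) / poch (α q + β + len n + 1) (n q) := by
  rw [typeII, mellinPart_sum]
  have hcoeff : ∀ l : Fin p → ℕ, typeIICoeff α β n l = (-1) ^ len n *
      (∏ q, poch (α q + 1) (n q) / poch (α q + β + len n + 1) (n q)) *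
        ∏ q, typeIIFactor α β n l q := by
    intro l
    rw [typeIICoeff, mul_assoc, ← prod_mul_distrib]
    simp only [typeIIFactor, mul_assoc]
  have : ∀ l ∈ Fintype.piFinset (fun q => range (n q + 1)),
      mellinPart β (len n) (C (typeIICoeff α β n l) * X ^ ∑ q, l q) s = (-1) ^ len n *
      (∏ q, poch (α q + 1) (n q) / poch (α q + β + len n + 1) (n q)) *
        ((∏ q, typeIIFactor α β n l q) *
        (poch (s + 1) (∑ q, l q) * poch (s + β + 2 + (∑ q, l q : ℕ)) (len n - ∑ q, l q))) := by
    intro l hl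
    rw [mellinPart_C_mul_X_pow _ _ (sum_le_len hl), hcoeff]
    ring
  rw [sum_congr rfl this, ← mul_sum, sum_typeIIFactor α hα, mul_assoc, mul_assoc,
    mul_left_comm (∏ q, _) (poch _ _), ← prod_mul_distrib]
  congr 2
  refine prod_congr rfl fun q _ => ?_
  have := (poch_pos (show 0 < α q + 1 by linarith [hα q]) (n q)).ne'
  field_simp

lemma weightedIntegral_typeII {p : ℕ} {α : Fin p → ℝ} {β s : ℝ} (hα : ∀ i, -1 < α i)
    (hβ : -1 < β) (hs : -1 < s) (n : Fin p → ℕ) :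
    weightedIntegral s β (typeII α β n) =
      Real.Gamma (s + 1) * Real.Gamma (β + 1) / Real.Gamma (s + β + len n + 2) *
      ((-1) ^ len n * poch (β + 1) (len n) *
        ∏ q, poch (α q - s) (n q) / poch (α q + β + len n + 1) (n q)) := by
  rw [weightedIntegral_eq_mellinPart hs hβ (typeII_natDegree_le α β n), mellinPart_typeII hα]

/-- Comparing two evaluations of the Mellin polynomial at `-β - len n - 1` avoids isolating the top
term of the multiple sum: there every factor of the product formula is `1`. -/
lemma typeII_coeff_len {p : ℕ} {α : Fin p → ℝ} {β : ℝ} (hα : ∀ i, -1 < α i) (hβ : -1 < β)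
    (n : Fin p → ℕ) : (typeII α β n).coeff (len n) = 1 := by
  have h := mellinPart_eval β (len n) (typeII α β n)
  rw [mellinPart_typeII hα] at h
  have h1 : ((-1) ^ len n * poch (β + 1) (len n) : ℝ) ≠ 0 :=
    mul_ne_zero (by simp) (poch_pos (by linarith) _).ne'
  rw [prod_eq_one, mul_one] at h
  · exact mul_right_cancel₀ h1 (by rw [← h, one_mul])
  · intro q _
    rw [show α q - (-β - len n - 1) = α q + β + len n + 1 by ring]
    exact div_self (poch_add_len_pos hα hβ n q).ne'

lemma typeII_orthogonal {p : ℕ} {α : Fin p → ℝ} {β : ℝ} (hα : ∀ i, -1 < α i) (hβ : -1 < β)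
    (n : Fin p → ℕ) {i : Fin p} {j : ℕ} (hj : j < n i) :
    weightedIntegral (α i + j) β (typeII α β n) = 0 := by
  rw [weightedIntegral_typeII hα hβ (lt_of_lt_of_le (hα i) (by simp)),
    prod_eq_zero (mem_univ i)]
  · simp
  · rw [poch_eq_zero hj (by ring), zero_div]

lemma isTypeII_typeII {p : ℕ} {α : Fin p → ℝ} {β : ℝ} (hα : ∀ i, -1 < α i) (hβ : -1 < β)
    (n : Fin p → ℕ) : IsTypeII α β n (typeII α β n) :=
  ⟨monic_of_natDegree_le_of_coeff_eq_one _ (typeII_natDegree_le α β n) (typeII_coeff_len hα hβ n),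
    typeII_natDegree_le α β n, fun i j hj => by
      rw [weightedIntegral_X_pow_mul, typeII_orthogonal hα hβ n hj]⟩

/-! ### The type I polynomials -/

/-- The indices `(i, l)`, `l < n_i`, of the exponents `α_i + l` occurring in the type I vector. -/
def nodes {p : ℕ} (n : Fin p → ℕ) : Finset (Σ _ : Fin p, ℕ) := univ.sigma fun i => range (n i)

lemma mem_nodes {p : ℕ} {n : Fin p → ℕ} {x : Σ _ : Fin p, ℕ} : x ∈ nodes n ↔ x.2 < n x.1 := by
  simp [nodes]

lemma card_nodes {p : ℕ} (n : Fin p → ℕ) : #(nodes n) = len n := by simp [nodes, len]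

lemma prod_nodes_erase {p : ℕ} (n : Fin p → ℕ) (i : Fin p) (l : ℕ) (f : (Σ _ : Fin p, ℕ) → ℝ) :
    ∏ x ∈ (nodes n).erase ⟨i, l⟩, f x =
      (∏ q ∈ univ.erase i, ∏ j ∈ range (n q), f ⟨q, j⟩) *
        ∏ j ∈ (range (n i)).erase l, f ⟨i, j⟩ := by
  have : (nodes n).erase ⟨i, l⟩ =
      univ.sigma (Function.update (fun i => range (n i)) i ((range (n i)).erase l)) := by
    ext ⟨q, j⟩
    by_cases h : q = i
    · subst h; simp [nodes]
    · simp [nodes, h]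
  rw [this, prod_sigma, ← prod_erase_mul univ _ (mem_univ i), Function.update_self]
  congr 1
  refine prod_congr rfl fun q hq => ?_
  rw [Function.update_of_ne (ne_of_mem_erase hq)]

lemma prod_range_erase (l m : ℕ) (g : ℕ → ℝ) :
    ∏ j ∈ (range (l + 1 + m)).erase l, g j =
      (∏ j ∈ range l, g j) * ∏ j ∈ range m, g (l + 1 + j) := by
  induction m with
  | zero => simp [range_add_one]
  | succ m ih =>
    rw [← add_assoc, range_add_one, erase_insert_of_ne (by omega), prod_insert (by simp), ih,
      prod_range_succ]
    ring

lemma prod_sub_eq_poch (d : ℝ) (n : ℕ) : ∏ j ∈ range n, (d - j) = poch (d - n + 1) n := by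
  have h := poch_neg d n
  have h2 : ((-1 : ℝ) ^ n) * (-1) ^ n = 1 := by rw [← mul_pow]; simp
  calc _ = (-1) ^ n * poch (-d) n := by
        rw [poch_eq_prod]
        conv_rhs => rw [← card_range n, ← prod_const, card_range, ← prod_mul_distrib]
        exact prod_congr rfl fun j _ => by ring
    _ = _ := by rw [h, ← mul_assoc, h2, one_mul]

lemma prod_neg_sub_eq_poch (x : ℝ) (n : ℕ) :
    ∏ j ∈ range n, (-x - j) = (-1) ^ n * poch x n := by
  rw [poch_eq_prod]
  conv_rhs => rw [← card_range n, ← prod_const, card_range, ← prod_mul_distrib]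
  exact prod_congr rfl fun j _ => by ring

/-- The product is the Lagrange basis polynomial of the node `α i + l` evaluated at `-β - len n`.
The Gamma quotient is the one that cancels against the Mellin transform of a polynomial of degree
below `len n`. -/
lemma typeICoeff_eq {p : ℕ} {α : Fin p → ℝ} {β : ℝ} (hα : ∀ i, -1 < α i) (hβ : -1 < β)
    (hαα : ∀ i j, i ≠ j → ∀ z : ℤ, α i - α j ≠ z) (n : Fin p → ℕ) {i : Fin p} {l : ℕ}
    (hl : l < n i) :
    typeICoeff α β n i l = (-1) ^ (len n - 1) *
      (Real.Gamma (α i + l + β + len n + 1) /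
        (Real.Gamma (α i + l + 1) * Real.Gamma (β + len n))) *
      ∏ x ∈ (nodes n).erase ⟨i, l⟩,
        (-β - len n - (α x.1 + x.2)) / (α i + l - (α x.1 + x.2)) := by
  have hN : (1 : ℝ) ≤ len n := by exact_mod_cast (Nat.zero_lt_of_lt hl).trans_le (le_len n i)
  have hsign : ∀ k : ℕ, ((-1 : ℝ) ^ k) * (-1) ^ k = 1 := fun k => by rw [← mul_pow]; simp
  set N : ℝ := (len n : ℝ) with hNdef
  have hq : ∀ q ∈ univ.erase i, ∏ j ∈ range (n q), (-β - N - (α q + j)) / (α i + l - (α q + j)) =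
      poch (α q + β + N) (n q) / poch (α q - α i) (n q) *
        (poch (α i - α q - n q + 1) l / poch (α i - α q + 1) l) := by
    intro q hq
    have hne : ∀ z : ℤ, α i - α q + z ≠ 0 := fun z hz =>
      hαα i q (ne_of_mem_erase hq).symm (-z) (by push_cast; linarith)
    rw [prod_div_distrib]
    have e1 : ∏ j ∈ range (n q), (-β - N - (α q + j)) = (-1) ^ n q * poch (α q + β + N) (n q) := by
      rw [← prod_neg_sub_eq_poch]
      exact prod_congr rfl fun j _ => by ring
    have e2 : ∏ j ∈ range (n q), (α i + l - (α q + j)) =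
        poch (α i - α q - n q + 1 + l) (n q) := by
      rw [show α i - α q - n q + 1 + l = α i - α q + l - n q + 1 by ring, ← prod_sub_eq_poch]
      exact prod_congr rfl fun j _ => by ring
    have e3 : poch (α q - α i) (n q) = (-1) ^ n q * poch (α i - α q - n q + 1) (n q) := by
      rw [← poch_neg, neg_sub]
    have e4 : poch (α i - α q - n q + 1) l * poch (α i - α q - n q + 1 + l) (n q) =
        poch (α i - α q - n q + 1) (n q) * poch (α i - α q + 1) l := by
      rw [← poch_add, add_comm l, poch_add]
      congr 2
      ring
    have n1 : poch (α i - α q - n q + 1) (n q) ≠ 0 := poch_ne_zero fun j _ h =>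
      hne (-n q + 1 + j) (by push_cast; linarith)
    have n2 : poch (α i - α q + 1) l ≠ 0 := poch_ne_zero fun j _ h =>
      hne (1 + j) (by push_cast; linarith)
    have n3 : poch (α i - α q - n q + 1 + l) (n q) ≠ 0 := poch_ne_zero fun j _ h =>
      hne (-n q + 1 + l + j) (by push_cast; linarith)
    have n4 : ((-1 : ℝ) ^ n q) ≠ 0 := by simp
    rw [e1, e2, e3, div_mul_div_comm, div_eq_div_iff n3 (by positivity)]
    calc _ = ((-1) ^ n q * (-1) ^ n q) * poch (α q + β + N) (n q) *
          (poch (α i - α q - n q + 1) (n q) * poch (α i - α q + 1) l) := by ring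
      _ = _ := by rw [hsign, ← e4]; ring
  -- Nodes sharing the index `i`: those below `l` produce the Pochhammer symbols in `l`, and those
  -- above complete the Gamma value to `Γ(α_i+β+N+n_i)`.
  have hi : Real.Gamma (α i + l + β + N + 1) / Real.Gamma (α i + l + 1) *
      ∏ j ∈ (range (n i)).erase l, (-β - N - (α i + j)) / (α i + l - (α i + j)) =
      Real.Gamma (α i + β + N + n i) / Real.Gamma (α i + 1) *
      ((poch (-(n i : ℝ) + 1) l * poch (α i + β + N) l) /
      ((Nat.factorial l : ℝ) * poch (α i + 1) l)) / (Nat.factorial (n i - 1) : ℝ) := by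
    obtain ⟨m, hm⟩ : ∃ m, n i = l + 1 + m := ⟨n i - (l + 1), by omega⟩
    have hx : 0 < α i + β + N + l + 1 := by
      have : (0 : ℝ) ≤ l := l.cast_nonneg
      linarith [hα i]
    rw [hm, prod_range_erase, prod_div_distrib, prod_div_distrib]
    have e1 : ∏ j ∈ range l, (-β - N - (α i + j)) = (-1) ^ l * poch (α i + β + N) l := by
      rw [← prod_neg_sub_eq_poch]
      exact prod_congr rfl fun j _ => by ring
    have e2 : ∏ j ∈ range m, (-β - N - (α i + (l + 1 + j : ℕ))) =
        (-1) ^ m * poch (α i + β + N + l + 1) m := by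
      rw [← prod_neg_sub_eq_poch]
      exact prod_congr rfl fun j _ => by push_cast; ring
    have e3 : ∏ j ∈ range l, (α i + l - (α i + j)) = (l.factorial : ℝ) := by
      rw [Nat.cast_factorial ℝ, ← poch, show (1 : ℝ) = (l : ℝ) - l + 1 by ring,
        ← prod_sub_eq_poch]
      exact prod_congr rfl fun j _ => by ring
    have e4 : ∏ j ∈ range m, (α i + l - (α i + (l + 1 + j : ℕ))) =
        (-1) ^ m * (m.factorial : ℝ) := by
      rw [Nat.cast_factorial ℝ, ← poch, ← prod_neg_sub_eq_poch]
      exact prod_congr rfl fun j _ => by push_cast; ring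
    have e5 : Real.Gamma (α i + β + N + (l + 1 + m : ℕ)) =
        poch (α i + β + N + l + 1) m * Real.Gamma (α i + β + N + l + 1) := by
      rw [← Gamma_add_nat hx]; push_cast; ring_nf
    have e6 : Real.Gamma (α i + l + 1) = poch (α i + 1) l * Real.Gamma (α i + 1) := by
      rw [← Gamma_add_nat (by linarith [hα i])]; ring_nf
    have e7 : poch (-((l + 1 + m : ℕ) : ℝ) + 1) l = (-1) ^ l * poch (m + 1) l := by
      rw [show -((l + 1 + m : ℕ) : ℝ) + 1 = -(l + m : ℝ) by push_cast; ring, poch_neg]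
      ring_nf
    have e8 : (m.factorial : ℝ) * poch (m + 1) l = ((l + 1 + m - 1).factorial : ℝ) := by
      rw [poch, factorial_mul_ascPochhammer]
      congr 2
      omega
    have n1 := (Real.Gamma_pos_of_pos (show 0 < α i + 1 by linarith [hα i])).ne'
    have n2 := (poch_pos (show 0 < α i + 1 by linarith [hα i]) l).ne'
    have n3 : (m.factorial : ℝ) ≠ 0 := by positivity
    have n4 : (l.factorial : ℝ) ≠ 0 := by positivity
    have n5 : poch (m + 1 : ℝ) l ≠ 0 := (poch_pos (by positivity) l).ne'
    rw [e1, e2, e3, e4, e5, e6, e7, ← e8,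
      show α i + l + β + N + 1 = α i + β + N + l + 1 by ring]
    have n6 : ((-1 : ℝ) ^ m) ≠ 0 := by simp
    field_simp
  rw [prod_nodes_erase, prod_congr rfl hq, prod_mul_distrib, prod_div_distrib, typeICoeff]
  calc _ = (-1) ^ (len n - 1) / Real.Gamma (β + N) *
      ((∏ q ∈ univ.erase i, poch (α q + β + N) (n q)) /
        (∏ q ∈ univ.erase i, poch (α q - α i) (n q))) *
      (∏ q ∈ univ.erase i, poch (α i - α q - n q + 1) l / poch (α i - α q + 1) l) *
      (Real.Gamma (α i + β + N + n i) / Real.Gamma (α i + 1) *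
      ((poch (-(n i : ℝ) + 1) l * poch (α i + β + N) l) /
      ((Nat.factorial l : ℝ) * poch (α i + 1) l)) / (Nat.factorial (n i - 1) : ℝ)) := by
        simp only [div_eq_mul_inv, mul_inv]
        ring
    _ = _ := by
        rw [← hi]
        simp only [div_eq_mul_inv, mul_inv]
        ring

lemma nodes_injOn {p : ℕ} {α : Fin p → ℝ} (hαα : ∀ i j, i ≠ j → ∀ z : ℤ, α i - α j ≠ z)
    (s : Set (Σ _ : Fin p, ℕ)) : Set.InjOn (fun x => α x.1 + x.2) s := by
  rintro ⟨i, l⟩ _ ⟨q, j⟩ _ h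
  simp only at h
  by_cases hiq : i = q
  · subst hiq
    simpa using h
  · exact absurd (show α i - α q = ((j - l : ℤ) : ℝ) by push_cast; linarith) (hαα i q hiq _)

/-- The linear functional `f ↦ ∑_i ∫ f A^{(i)} w_i dμ` given by the type I vector, in terms of the
values of the Mellin transform of `f` at the nodes. -/
noncomputable def typeIForm {p : ℕ} (α : Fin p → ℝ) (β : ℝ) (n : Fin p → ℕ) (f : ℝ[X]) : ℝ :=
  ∑ x ∈ nodes n, typeICoeff α β n x.1 x.2 * weightedIntegral (α x.1 + x.2) β f

lemma neg_one_lt_add_nat {a : ℝ} (ha : -1 < a) (l : ℕ) : -1 < a + l :=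
  lt_of_lt_of_le ha (by simp)

lemma weightedIntegral_mul_sum {a β : ℝ} (ha : -1 < a) (hβ : -1 < β) (f : ℝ[X]) (c : ℕ → ℝ)
    (m : ℕ) :
    weightedIntegral a β (f * ∑ l ∈ range m, C (c l) * X ^ l) =
      ∑ l ∈ range m, c l * weightedIntegral (a + l) β f := by
  rw [← weightedIntegralₗ_apply ha hβ, mul_sum, map_sum]
  refine sum_congr rfl fun l _ => ?_
  rw [show f * (C (c l) * X ^ l) = c l • (X ^ l * f) by rw [smul_eq_C_mul]; ring, map_smul,
    weightedIntegralₗ_apply, weightedIntegral_X_pow_mul, smul_eq_mul]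

lemma sum_weightedIntegral_typeI {p : ℕ} {α : Fin p → ℝ} {β : ℝ} (hα : ∀ i, -1 < α i)
    (hβ : -1 < β) (n : Fin p → ℕ) (f : ℝ[X]) :
    ∑ i, weightedIntegral (α i) β (f * typeI α β n i) = typeIForm α β n f := by
  rw [typeIForm, nodes, sum_sigma]
  exact sum_congr rfl fun i _ => weightedIntegral_mul_sum (hα i) hβ f _ _

/-- The form is Lagrange interpolation of the Mellin polynomial of `f` at `-β - len n = -β - N - 1`.
It is exact because the degree is at most `N` and there are `N + 1` distinct nodes. -/
lemma typeIForm_eq_coeff {p : ℕ} {α : Fin p → ℝ} {β : ℝ} (hα : ∀ i, -1 < α i) (hβ : -1 < β)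
    (hαα : ∀ i j, i ≠ j → ∀ z : ℤ, α i - α j ≠ z) (n : Fin p → ℕ) {N : ℕ} (hN : len n = N + 1)
    {f : ℝ[X]} (hf : f.natDegree ≤ N) : typeIForm α β n f = f.coeff N := by
  obtain ⟨P, hPdeg, hP⟩ := exists_mellinPoly β N f
  have hβN : 0 < β + len n := by rw [hN]; push_cast; have : (0 : ℝ) ≤ N := N.cast_nonneg; linarith
  have hterm : ∀ x ∈ nodes n, typeICoeff α β n x.1 x.2 * weightedIntegral (α x.1 + x.2) β f =
      (-1) ^ N * (Real.Gamma (β + 1) / Real.Gamma (β + len n)) *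
        (P.eval (α x.1 + x.2) * ∏ y ∈ (nodes n).erase x,
          (-β - len n - (α y.1 + y.2)) / (α x.1 + x.2 - (α y.1 + y.2))) := by
    rintro ⟨i, l⟩ hx
    have ht := neg_one_lt_add_nat (hα i) l
    rw [typeICoeff_eq hα hβ hαα n (mem_nodes.1 hx), weightedIntegral_eq_mellinPart ht hβ hf, hP]
    have n1 := (Real.Gamma_pos_of_pos (show 0 < α i + l + 1 by linarith)).ne'
    have n2 := (Real.Gamma_pos_of_pos (show 0 < α i + l + β + len n + 1 by linarith)).ne'
    have n3 := (Real.Gamma_pos_of_pos hβN).ne'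
    rw [show α i + l + β + N + 2 = α i + l + β + len n + 1 by rw [hN]; push_cast; ring,
      show len n - 1 = N by omega]
    field_simp
  have hL : P.eval (-β - len n) = ∑ x ∈ nodes n, P.eval (α x.1 + x.2) *
      ∏ y ∈ (nodes n).erase x,
          (-β - len n - (α y.1 + y.2)) / (α x.1 + x.2 - (α y.1 + y.2)) := by
    have hdeg : P.degree < #(nodes n) := by
      rw [card_nodes, hN]
      exact lt_of_le_of_lt (degree_le_of_natDegree_le hPdeg) (by exact_mod_cast Nat.lt_succ_self N)
    conv_lhs => rw [Lagrange.eq_interpolate (nodes_injOn hαα _) hdeg, Lagrange.interpolate_apply]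
    rw [eval_finsetSum]
    refine sum_congr rfl fun x _ => ?_
    rw [eval_mul, eval_C, Lagrange.basis, eval_prod]
    congr 1
    refine prod_congr rfl fun y _ => ?_
    simp [Lagrange.basisDivisor]
    ring
  rw [typeIForm, sum_congr rfl hterm, ← mul_sum, ← hL, hP,
    show -β - (len n : ℝ) = -β - N - 1 by rw [hN]; push_cast; ring, mellinPart_eval,
    show β + (len n : ℝ) = β + 1 + N by rw [hN]; push_cast; ring, Gamma_add_nat (by linarith)]
  have n1 := (Real.Gamma_pos_of_pos (show 0 < β + 1 by linarith)).ne'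
  have n2 := (poch_pos (show 0 < β + 1 by linarith) N).ne'
  have hsign : ((-1 : ℝ) ^ N) * (-1) ^ N = 1 := by rw [← mul_pow]; simp
  field_simp
  linear_combination f.coeff N * hsign

/-! ### Biorthogonality and uniqueness -/

section Biorthogonality

variable {p : ℕ} {α : Fin p → ℝ} {β : ℝ}

/-- The bilinear form `(A, f) ↦ ∑_i ∫ f A_i w_i dμ`. -/
noncomputable def pairing (hα : ∀ i, -1 < α i) (hβ : -1 < β) :
    (Fin p → ℝ[X]) →ₗ[ℝ] ℝ[X] →ₗ[ℝ] ℝ :=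
  LinearMap.mk₂ ℝ (fun A f => ∑ i, weightedIntegralₗ (hα i) hβ (f * A i))
    (fun A A' f => by simp [mul_add, sum_add_distrib])
    (fun c A f => by simp [mul_sum])
    (fun A f f' => by simp [add_mul, sum_add_distrib])
    (fun c A f => by simp [mul_sum])

lemma pairing_apply (hα : ∀ i, -1 < α i) (hβ : -1 < β) (A : Fin p → ℝ[X]) (f : ℝ[X]) :
    pairing hα hβ A f = ∑ i, weightedIntegral (α i) β (f * A i) := rfl

lemma pairing_X_mul (hα : ∀ i, -1 < α i) (hβ : -1 < β) (A : Fin p → ℝ[X]) (f : ℝ[X]) :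
    pairing hα hβ (fun i => X * A i) f = pairing hα hβ A (X * f) := by
  simp only [pairing_apply, mul_left_comm, mul_assoc]

lemma pairing_typeI (hα : ∀ i, -1 < α i) (hβ : -1 < β) (n : Fin p → ℕ) (f : ℝ[X]) :
    pairing hα hβ (typeI α β n) f = typeIForm α β n f :=
  sum_weightedIntegral_typeI hα hβ n f

lemma typeIForm_eq_coeff_of_degree_lt (hα : ∀ i, -1 < α i) (hβ : -1 < β)
    (hαα : ∀ i j, i ≠ j → ∀ z : ℤ, α i - α j ≠ z) (n : Fin p → ℕ)
    {f : ℝ[X]} (hf : f.degree < (len n : ℕ)) : typeIForm α β n f = f.coeff (len n - 1) := by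
  rcases Nat.eq_zero_or_eq_succ_pred (len n) with h | h
  · have : f = 0 := by
      rw [h] at hf
      simpa using hf
    rw [← pairing_typeI hα hβ, this]
    simp
  · rw [h] at hf
    exact typeIForm_eq_coeff hα hβ hαα n h (Nat.lt_succ_iff.1 (by
      rcases eq_or_ne f 0 with rfl | h0
      · simp
      · exact (natDegree_lt_iff_degree_lt h0).2 hf))

lemma typeIForm_eq_zero_of_orthogonal {n : Fin p → ℕ} {f : ℝ[X]}
    (hf : ∀ i l, l < n i → weightedIntegral (α i + l) β f = 0) : typeIForm α β n f = 0 :=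
  sum_eq_zero fun x hx => by rw [hf _ _ (mem_nodes.1 hx), mul_zero]

lemma exists_le_len_eq (n : Fin p → ℕ) {k : ℕ} (hk : k ≤ len n) : ∃ m ≤ n, len m = k := by
  induction k with
  | zero => exact ⟨0, fun i => Nat.zero_le _, by simp [len]⟩
  | succ k ih =>
    obtain ⟨m, hm, hmk⟩ := ih (by omega)
    obtain ⟨i, -, hi⟩ := exists_lt_of_sum_lt (s := univ) (f := m) (g := n)
      (show len m < len n by omega)
    refine ⟨m + Pi.single i 1, fun q => ?_, ?_⟩
    · by_cases h : q = i
      · subst h; simpa using hi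
      · simpa [h] using hm q
    · simp only [len, Pi.add_apply, sum_add_distrib] at hmk ⊢
      simp [hmk]

/-- For `m ≤ n` with `len m = deg f + 1`, the type I form of `m` returns the leading coefficient of
`f`, yet it vanishes by orthogonality. -/
lemma eq_zero_of_orthogonal (hα : ∀ i, -1 < α i) (hβ : -1 < β)
    (hαα : ∀ i j, i ≠ j → ∀ z : ℤ, α i - α j ≠ z) {n : Fin p → ℕ} {f : ℝ[X]}
    (hdeg : f.degree < (len n : ℕ))
    (hf : ∀ i l, l < n i → weightedIntegral (α i + l) β f = 0) : f = 0 := by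
  by_contra h0
  have hlt : f.natDegree < len n := (natDegree_lt_iff_degree_lt h0).2 hdeg
  obtain ⟨m, hm, hmk⟩ := exists_le_len_eq n (Nat.succ_le_of_lt hlt)
  have h1 := typeIForm_eq_coeff hα hβ hαα m hmk le_rfl
  rw [typeIForm_eq_zero_of_orthogonal fun i l hl => hf i l (hl.trans_le (hm i))] at h1
  exact h0 (leadingCoeff_eq_zero.1 h1.symm)

lemma typeII_monic (hα : ∀ i, -1 < α i) (hβ : -1 < β) (n : Fin p → ℕ) :
    (typeII α β n).Monic := (isTypeII_typeII hα hβ n).1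

lemma typeII_natDegree (hα : ∀ i, -1 < α i) (hβ : -1 < β) (n : Fin p → ℕ) :
    (typeII α β n).natDegree = len n :=
  le_antisymm (typeII_natDegree_le α β n)
    (le_natDegree_of_ne_zero (by rw [typeII_coeff_len hα hβ]; exact one_ne_zero))

lemma typeII_degree (hα : ∀ i, -1 < α i) (hβ : -1 < β) (n : Fin p → ℕ) :
    (typeII α β n).degree = (len n : ℕ) := by
  rw [degree_eq_natDegree (typeII_monic hα hβ n).ne_zero, typeII_natDegree hα hβ]

lemma isTypeII_iff (hα : ∀ i, -1 < α i) (hβ : -1 < β)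
    (hαα : ∀ i j, i ≠ j → ∀ z : ℤ, α i - α j ≠ z) (n : Fin p → ℕ) (B : ℝ[X]) :
    IsTypeII α β n B ↔ B = typeII α β n := by
  refine ⟨fun ⟨hmon, hdeg, horth⟩ => ?_, fun h => h ▸ isTypeII_typeII hα hβ n⟩
  have horth' : ∀ i l, l < n i → weightedIntegral (α i + l) β B = 0 := fun i l hl => by
    rw [← weightedIntegral_X_pow_mul, horth i l hl]
  -- Below full degree `B` itself would be zero, against monicity; at full degree the leading terms
  -- cancel in the difference.
  rcases hdeg.lt_or_eq with h | h
  · refine absurd (eq_zero_of_orthogonal hα hβ hαα (n := n) ?_ horth') hmon.ne_zero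
    exact (natDegree_lt_iff_degree_lt hmon.ne_zero).1 h
  · refine sub_eq_zero.1 (eq_zero_of_orthogonal hα hβ hαα (n := n) ?_ fun i l hl => ?_)
    · rw [← typeII_degree hα hβ, ← degree_neg (typeII α β n), ← degree_neg, neg_sub, degree_neg]
      refine degree_sub_lt_left ?_ (typeII_monic hα hβ n).ne_zero ?_
      · rw [typeII_degree hα hβ, degree_eq_natDegree hmon.ne_zero, h]
      · rw [(typeII_monic hα hβ n).leadingCoeff, hmon.leadingCoeff]
    · have hl' := neg_one_lt_add_nat (hα i) l
      rw [← weightedIntegralₗ_apply hl' hβ, map_sub, weightedIntegralₗ_apply,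
        weightedIntegralₗ_apply, horth' i l hl, typeII_orthogonal hα hβ n hl, sub_zero]

lemma typeIForm_X_pow (hα : ∀ i, -1 < α i) (hβ : -1 < β)
    (hαα : ∀ i j, i ≠ j → ∀ z : ℤ, α i - α j ≠ z) (n : Fin p → ℕ) {j : ℕ} (hj : j < len n) :
    typeIForm α β n (X ^ j) = if j + 1 = len n then 1 else 0 := by
  rw [typeIForm_eq_coeff_of_degree_lt hα hβ hαα n (by rw [degree_X_pow]; exact_mod_cast hj),
    coeff_X_pow]
  congr 1
  exact propext (by omega)

lemma typeI_mem_degreeLT (n : Fin p → ℕ) (i : Fin p) : typeI α β n i ∈ degreeLT ℝ (n i) :=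
  Submodule.sum_mem _ fun l hl => mem_degreeLT.2 <|
    (degree_C_mul_X_pow_le _ _).trans_lt (by exact_mod_cast mem_range.1 hl)

lemma isTypeI_typeI (hα : ∀ i, -1 < α i) (hβ : -1 < β)
    (hαα : ∀ i j, i ≠ j → ∀ z : ℤ, α i - α j ≠ z) (n : Fin p → ℕ) :
    IsTypeI α β n (typeI α β n) :=
  ⟨fun i => mem_degreeLT.1 (typeI_mem_degreeLT n i), fun j hj => by
    rw [sum_weightedIntegral_typeI hα hβ, typeIForm_X_pow hα hβ hαα n hj]⟩

lemma len_add_single (n : Fin p → ℕ) (k : Fin p) : len (n + Pi.single k 1) = len n + 1 := by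
  simp [len, sum_add_distrib]

lemma len_add (n m : Fin p → ℕ) : len (n + m) = len n + len m := by
  simp [len, sum_add_distrib]

lemma len_sub {n m : Fin p → ℕ} (h : m ≤ n) : len (n - m) = len n - len m := by
  have : len n = len (n - m) + len m := by rw [← len_add, tsub_add_cancel_of_le h]
  omega

/-- `α i + n i` is the first exponent past the zeros belonging to `i`, and the zeros of the other
indices are excluded by the non-integer differences. -/
lemma weightedIntegral_typeII_ne_zero (hα : ∀ i, -1 < α i) (hβ : -1 < β)
    (hαα : ∀ i j, i ≠ j → ∀ z : ℤ, α i - α j ≠ z) (n : Fin p → ℕ) (i : Fin p) :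
    weightedIntegral (α i + n i) β (typeII α β n) ≠ 0 := by
  have hs := neg_one_lt_add_nat (hα i) (n i)
  rw [weightedIntegral_typeII hα hβ hs]
  have hN : (n i : ℝ) ≤ len n := by exact_mod_cast le_len n i
  have hN0 : (0 : ℝ) ≤ len n := Nat.cast_nonneg _
  refine mul_ne_zero (div_ne_zero (mul_ne_zero (Real.Gamma_pos_of_pos (by linarith)).ne'
    (Real.Gamma_pos_of_pos (by linarith)).ne') (Real.Gamma_pos_of_pos (by linarith)).ne')
    (mul_ne_zero (mul_ne_zero (by simp) (poch_pos (by linarith) _).ne')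
    (prod_ne_zero_iff.2 fun q _ => div_ne_zero (poch_ne_zero fun j hj h => ?_)
      (poch_add_len_pos hα hβ n q).ne'))
  by_cases hq : q = i
  · subst hq
    have : (j : ℝ) < n q := by exact_mod_cast hj
    linarith
  · exact hαα q i hq (n i - j) (by push_cast; linarith)

lemma eq_sum_of_mem_degreeLT {f : ℝ[X]} {m : ℕ} (hf : f ∈ degreeLT ℝ m) :
    f = ∑ l ∈ range m, C (f.coeff l) * X ^ l := by
  ext k
  simp only [finsetSum_coeff, coeff_C_mul_X_pow, sum_ite_eq, mem_range]
  split_ifs with h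
  · rfl
  · exact (degree_lt_iff_coeff_zero _ _).1 (mem_degreeLT.1 hf) k (not_lt.1 h)

/-- Induction on the length. With `n = m + e_i`, the polynomial `typeII α β m` is orthogonal to all
nodes of `n` except `(i, m i)`. Testing against it kills the top coefficient of `V i`, so `V`
already fits `m`. -/
lemma eq_zero_of_pairing_eq_zero (hα : ∀ i, -1 < α i) (hβ : -1 < β)
    (hαα : ∀ i j, i ≠ j → ∀ z : ℤ, α i - α j ≠ z) {n : Fin p → ℕ} {V : Fin p → ℝ[X]}
    (hV : ∀ i, V i ∈ degreeLT ℝ (n i))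
    (h : ∀ f : ℝ[X], f.degree < (len n : ℕ) → pairing hα hβ V f = 0) : V = 0 := by
  obtain ⟨N, hN⟩ : ∃ N, len n = N := ⟨_, rfl⟩
  induction N generalizing n with
  | zero =>
    ext1 i
    have hi : n i = 0 := Nat.le_zero.1 (hN ▸ le_len n i)
    have := mem_degreeLT.1 (hV i)
    rw [hi] at this
    simpa using this
  | succ N ih =>
    obtain ⟨i, -, hi⟩ := exists_ne_zero_of_sum_ne_zero (s := univ) (f := n)
      (show len n ≠ 0 by omega)
    obtain ⟨m, rfl⟩ : ∃ m, n = m + Pi.single i 1 :=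
      ⟨n - Pi.single i 1, (tsub_add_cancel_of_le fun q => by
        by_cases hq : q = i
        · subst hq; simpa using Nat.one_le_iff_ne_zero.2 hi
        · simp [hq]).symm⟩
    have hm : len m = N := by rw [len_add_single] at hN; omega
    have hsum : ∀ q, V q = ∑ l ∈ range ((m + Pi.single i 1 : Fin p → ℕ) q), C ((V q).coeff l) * X ^ l :=
      fun q => eq_sum_of_mem_degreeLT (hV q)
    have hB := h (typeII α β m) (by
      rw [typeII_degree hα hβ, len_add_single]; exact_mod_cast Nat.lt_succ_self _)
    have hterm : ∀ q, weightedIntegral (α q) β (typeII α β m * V q) =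
        ∑ l ∈ range ((m + Pi.single i 1 : Fin p → ℕ) q),
          (V q).coeff l * weightedIntegral (α q + l) β (typeII α β m) := by
      intro q
      conv_lhs => rw [hsum q]
      exact weightedIntegral_mul_sum (hα q) hβ _ _ _
    rw [pairing_apply, sum_eq_single i] at hB
    · rw [hterm, Pi.add_apply, Pi.single_eq_same, sum_range_succ, sum_eq_zero, zero_add] at hB
      · have hc : (V i).coeff (m i) = 0 :=
          (mul_eq_zero.1 hB).resolve_right (weightedIntegral_typeII_ne_zero hα hβ hαα m i)
        refine ih (n := m) (fun q => ?_) (fun f hf => h f (hf.trans ?_)) hm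
        · by_cases hq : q = i
          · subst hq
            have hVq := mem_degreeLT.1 (hV q)
            rw [mem_degreeLT, degree_lt_iff_coeff_zero]
            rw [degree_lt_iff_coeff_zero] at hVq
            intro l hl
            rcases hl.eq_or_lt with rfl | hl
            · exact hc
            · exact hVq l (by simpa using hl)
          · simpa [hq] using hV q
        · rw [len_add_single]; exact_mod_cast Nat.lt_succ_self _
      · intro l hl
        rw [typeII_orthogonal hα hβ m (mem_range.1 hl), mul_zero]
    · intro q _ hq
      rw [hterm]
      refine sum_eq_zero fun l hl => ?_
      rw [typeII_orthogonal hα hβ m (by simpa [hq] using hl), mul_zero]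
    · simp

/-- Allows a different convenient test polynomial in each degree: powers of `X` for uniqueness, a
mixture of powers and type II polynomials for the type I recurrence. -/
lemma eq_zero_of_monic_basis {φ : ℝ[X] →ₗ[ℝ] ℝ} {M : ℕ}
    (h : ∀ d < M, ∃ g : ℝ[X], g.Monic ∧ g.natDegree = d ∧ φ g = 0) {f : ℝ[X]}
    (hf : f.degree < (M : ℕ)) : φ f = 0 := by
  induction M generalizing f with
  | zero =>
    have : f = 0 := by simpa using hf
    simp [this]
  | succ M ih =>
    obtain ⟨g, hg, hgd, hφ⟩ := h M (Nat.lt_succ_self M)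
    have hsub : (f - f.coeff M • g).degree < (M : ℕ) := by
      rw [degree_lt_iff_coeff_zero] at hf ⊢
      intro l hl
      rcases hl.eq_or_lt with rfl | hl
      · have : g.coeff M = 1 := by rw [← hgd]; exact hg
        simp [this]
      · rw [coeff_sub, coeff_smul, hf l hl, coeff_eq_zero_of_natDegree_lt (p := g) (by omega)]
        simp
    have := ih (fun d hd => h d (hd.trans (Nat.lt_succ_self M))) hsub
    rwa [map_sub, map_smul, hφ, smul_zero, sub_zero] at this

lemma isTypeI_iff (hα : ∀ i, -1 < α i) (hβ : -1 < β)
    (hαα : ∀ i j, i ≠ j → ∀ z : ℤ, α i - α j ≠ z) (n : Fin p → ℕ) (A : Fin p → ℝ[X]) :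
    IsTypeI α β n A ↔ A = typeI α β n := by
  refine ⟨fun h => ?_, fun h => h ▸ isTypeI_typeI hα hβ hαα n⟩
  have h' := isTypeI_typeI hα hβ hαα n
  refine sub_eq_zero.1 (eq_zero_of_pairing_eq_zero hα hβ hαα (n := n)
    (fun i => Submodule.sub_mem _ (mem_degreeLT.2 (h.1 i)) (mem_degreeLT.2 (h'.1 i)))
    fun f hf => eq_zero_of_monic_basis (fun d hd => ⟨X ^ d, monic_X_pow d, natDegree_X_pow d, ?_⟩)
      hf)
  rw [map_sub, LinearMap.sub_apply, pairing_apply, pairing_apply, h.2 d hd, h'.2 d hd, sub_self]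

lemma typeIForm_typeII_of_le (hα : ∀ i, -1 < α i) (hβ : -1 < β) {m n : Fin p → ℕ} (h : m ≤ n) :
    typeIForm α β m (typeII α β n) = 0 :=
  typeIForm_eq_zero_of_orthogonal fun i _ hl => typeII_orthogonal hα hβ n (hl.trans_le (h i))

/-- Here `typeII α β n` is of low enough degree for the form to read off a coefficient, and it is
monic. Together with the case `m ≤ n` this is all the biorthogonality the recurrences need. -/
lemma typeIForm_typeII_of_len_lt (hα : ∀ i, -1 < α i) (hβ : -1 < β)
    (hαα : ∀ i j, i ≠ j → ∀ z : ℤ, α i - α j ≠ z) {m n : Fin p → ℕ} (h : len n < len m) :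
    typeIForm α β m (typeII α β n) = if len n + 1 = len m then 1 else 0 := by
  rw [typeIForm_eq_coeff_of_degree_lt hα hβ hαα m
    (by rw [typeII_degree hα hβ]; exact_mod_cast h)]
  split_ifs with h1
  · rw [show len m - 1 = len n by omega, typeII_coeff_len hα hβ]
  · exact coeff_eq_zero_of_natDegree_lt (by rw [typeII_natDegree hα hβ]; omega)

/-! ### The multi-indices `s_j` -/

lemma stepIndex_apply (π : Equiv.Perm (Fin p)) (j : ℕ) (i : Fin p) :
    stepIndex π j i = if (π.symm i : ℕ) < j then 1 else 0 := by
  rw [stepIndex, Finset.sum_apply, sum_filter, sum_eq_single (π.symm i)]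
  · simp
  · intro m _ hm
    have : i ≠ π m := fun h => hm (by simp [h])
    simp [this]
  · simp

lemma len_stepIndex (π : Equiv.Perm (Fin p)) {j : ℕ} (hj : j ≤ p) : len (stepIndex π j) = j := by
  simp only [len, stepIndex_apply]
  rw [Equiv.sum_comp π.symm (fun m : Fin p => if (m : ℕ) < j then 1 else 0),
    Fin.sum_univ_eq_sum_range (fun m => if m < j then 1 else 0) p, ← sum_filter, sum_const,
    smul_eq_mul, mul_one, show (range p).filter (· < j) = range j by ext; simp; omega, card_range]

lemma stepIndex_mono (π : Equiv.Perm (Fin p)) {j j' : ℕ} (h : j ≤ j') :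
    stepIndex π j ≤ stepIndex π j' := by
  intro i
  rw [stepIndex_apply, stepIndex_apply]
  split_ifs with h1 h2
  · rfl
  · exact absurd (h1.trans_le h) h2
  · exact Nat.zero_le _
  · rfl

lemma stepIndex_zero (π : Equiv.Perm (Fin p)) : stepIndex π 0 = 0 := by
  ext i; simp [stepIndex_apply]

end Biorthogonality

/-! ### The recurrence relations -/

section Recurrence

variable {p : ℕ} {α : Fin p → ℝ} {β : ℝ}

lemma typeIISub_of_le {n s : Fin p → ℕ} (h : s ≤ n) :
    typeIISub α β n s = typeII α β (n - s) := if_pos h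

lemma typeIISub_of_not_le {n s : Fin p → ℕ} (h : ¬ s ≤ n) : typeIISub α β n s = 0 := if_neg h

lemma typeIForm_zero (hα : ∀ i, -1 < α i) (hβ : -1 < β) (m : Fin p → ℕ) :
    typeIForm α β m 0 = 0 := by
  rw [← pairing_typeI hα hβ, map_zero]

/-- If no zero entry precedes a nonzero one in the order given by `π`, then some `n - s_r` is
obtained from `n` by lowering all nonzero entries by one. -/
lemma exists_stepIndex_sub (π : Equiv.Perm (Fin p)) (n : Fin p → ℕ)
    (hn : ∀ i j : Fin p, i < j → n (π j) ≠ 0 → n (π i) ≠ 0) :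
    ∃ r ≤ p, (∀ j ≤ p, stepIndex π j ≤ n ↔ j ≤ r) ∧ ∀ i, (n - stepIndex π r) i = n i - 1 := by
  classical
  set r := Nat.findGreatest (fun j => stepIndex π j ≤ n) p with hr
  have hrp : r ≤ p := Nat.findGreatest_le p
  have hspec : stepIndex π r ≤ n :=
    Nat.findGreatest_spec (P := fun j => stepIndex π j ≤ n) (Nat.zero_le p)
      (by rw [stepIndex_zero]; exact fun _ => Nat.zero_le _)
  refine ⟨r, hrp, fun j hj => ⟨fun h => Nat.le_findGreatest hj h,
    fun h => (stepIndex_mono π h).trans hspec⟩, fun i => ?_⟩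
  rw [Pi.sub_apply, stepIndex_apply]
  split_ifs with hi
  · rfl
  · by_cases h0 : n i = 0
    · rw [h0]
    · have hlt : (π.symm i : ℕ) < p := (π.symm i).2
      -- A nonzero entry at position `r` or later forces the first `r + 1` entries to be nonzero,
      -- against the maximality of `r`.
      have hle : stepIndex π (r + 1) ≤ n := by
        intro q
        rw [stepIndex_apply]
        split_ifs with hq
        · refine Nat.one_le_iff_ne_zero.2 ?_
          rcases (show (π.symm q : ℕ) ≤ π.symm i by omega).eq_or_lt with h | h
          · rwa [π.symm.injective (Fin.ext h)]
          · simpa using hn (π.symm q) (π.symm i) h (by simpa using h0)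
        · exact Nat.zero_le _
      have : r + 1 ≤ r := Nat.le_findGreatest (P := fun j => stepIndex π j ≤ n) (by omega) hle
      omega

/-- A nonzero remainder `R` would have its leading coefficient detected by a type I form of length
`deg R + 1`. Such forms along the chain `n + e_k`, `n`, `n - s_1`, … annihilate `R` by the choice of
coefficients; below the chain, orthogonality takes over. -/
lemma typeII_recurrence (hα : ∀ i, -1 < α i) (hβ : -1 < β)
    (hαα : ∀ i j, i ≠ j → ∀ z : ℤ, α i - α j ≠ z) (π : Equiv.Perm (Fin p)) (n : Fin p → ℕ)
    (k : Fin p) (hn : ∀ i j : Fin p, i < j → n (π j) ≠ 0 → n (π i) ≠ 0) :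
    X * typeII α β n = typeII α β (n + Pi.single k 1) +
      C (typeIForm α β (n + Pi.single k 1) (X * typeII α β n)) * typeII α β n +
      ∑ j ∈ Icc 1 p, C (typeIForm α β (n - stepIndex π (j - 1)) (X * typeII α β n)) *
        typeIISub α β n (stepIndex π j) := by
  obtain ⟨r, hrp, hr, hsub⟩ := exists_stepIndex_sub π n hn
  set b : ℕ → ℝ := fun j => typeIForm α β (n - stepIndex π (j - 1)) (X * typeII α β n) with hb
  set b₀ := typeIForm α β (n + Pi.single k 1) (X * typeII α β n) with hb₀
  set R : ℝ[X] := X * typeII α β n - typeII α β (n + Pi.single k 1) - b₀ • typeII α β n -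
    ∑ j ∈ Icc 1 p, b j • typeIISub α β n (stepIndex π j) with hRdef
  suffices hR : R = 0 by
    rw [sub_eq_zero, sub_eq_iff_eq_add, sub_eq_iff_eq_add] at hR
    refine hR.trans ?_
    simp only [smul_eq_C_mul]
    ring
  have hform : ∀ m : Fin p → ℕ, typeIForm α β m R = typeIForm α β m (X * typeII α β n) -
      typeIForm α β m (typeII α β (n + Pi.single k 1)) - b₀ * typeIForm α β m (typeII α β n) -
      ∑ j ∈ Icc 1 p, b j * typeIForm α β m (typeIISub α β n (stepIndex π j)) := by
    intro m
    simp only [← pairing_typeI hα hβ, hRdef, map_sub, map_smul, map_sum, smul_eq_mul]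
  have hlenr : r ≤ len n := by
    have := len_add (n - stepIndex π r) (stepIndex π r)
    rw [tsub_add_cancel_of_le ((hr r hrp).2 le_rfl), len_stepIndex π hrp] at this
    omega
  have hlensub : ∀ j ≤ r, len (n - stepIndex π j) = len n - j := fun j hj => by
    rw [len_sub ((hr j (hj.trans hrp)).2 hj), len_stepIndex π (hj.trans hrp)]
  have hsubdeg : ∀ j ∈ Icc 1 p, (typeIISub α β n (stepIndex π j)).degree < (len n : ℕ) := by
    intro j hj
    obtain ⟨hj1, hjp⟩ := mem_Icc.1 hj
    by_cases hjr : j ≤ r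
    · rw [typeIISub_of_le ((hr j hjp).2 hjr), typeII_degree hα hβ, hlensub j hjr]
      exact_mod_cast (by omega)
    · rw [typeIISub_of_not_le fun h => hjr ((hr j hjp).1 h), degree_zero]
      exact WithBot.bot_lt_coe _
  have hlt : ((len n : ℕ) : WithBot ℕ) < (len n + 1 : ℕ) := by
    exact_mod_cast Nat.lt_succ_self _
  have hdegR : R ∈ degreeLT ℝ (len n + 1) := by
    refine Submodule.sub_mem _ (Submodule.sub_mem _ (mem_degreeLT.2 ?_)
      (Submodule.smul_mem _ _ (mem_degreeLT.2 (by rwa [typeII_degree hα hβ]))))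
      (Submodule.sum_mem _ fun j hj => Submodule.smul_mem _ _
        (mem_degreeLT.2 ((hsubdeg j hj).trans hlt)))
    have hX : (X * typeII α β n).Monic := monic_X.mul (typeII_monic hα hβ n)
    have hXd : (X * typeII α β n).degree = ((len n + 1 : ℕ) : WithBot ℕ) := by
      rw [degree_eq_natDegree hX.ne_zero, natDegree_X_mul (typeII_monic hα hβ n).ne_zero,
        typeII_natDegree hα hβ]
    rw [← hXd]
    refine degree_sub_lt_left ?_ hX.ne_zero ?_
    · rw [hXd, typeII_degree hα hβ, len_add_single]
    · rw [hX.leadingCoeff, (typeII_monic hα hβ _).leadingCoeff]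
  have hle : n ≤ n + Pi.single k 1 := le_self_add
  by_contra hR0
  have hd : R.natDegree < len n + 1 := (natDegree_lt_iff_degree_lt hR0).2 (mem_degreeLT.1 hdegR)
  have hcoeff : ∀ m : Fin p → ℕ, len m = R.natDegree + 1 → typeIForm α β m R ≠ 0 := by
    intro m hm
    rw [typeIForm_eq_coeff hα hβ hαα m hm le_rfl]
    exact leadingCoeff_ne_zero.2 hR0
  rcases (Nat.lt_succ_iff.1 hd).eq_or_lt with hd' | hd'
  · refine hcoeff (n + Pi.single k 1) (by rw [len_add_single, hd']) ?_
    rw [hform, typeIForm_typeII_of_le hα hβ le_rfl, typeIForm_typeII_of_len_lt hα hβ hαα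
      (by rw [len_add_single]; omega), if_pos (by rw [len_add_single]), sum_eq_zero]
    · rw [hb₀]; ring
    · intro j hj
      rw [typeIForm_eq_coeff hα hβ hαα _ (len_add_single n k),
        coeff_eq_zero_of_degree_lt (hsubdeg j hj), mul_zero]
      exact natDegree_le_of_degree_le (hsubdeg j hj).le
  -- Past the end of the chain: `n - s_r` lowers every nonzero entry, so multiplication by `X`
  -- leaves `typeII α β n` orthogonal at all its nodes.
  rcases lt_or_ge R.natDegree (len n - r) with hdr | hdr
  · refine hR0 (eq_zero_of_orthogonal hα hβ hαα (n := n - stepIndex π r) ?_ ?_)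
    · rw [hlensub r le_rfl]
      exact (natDegree_lt_iff_degree_lt hR0).1 hdr
    · intro i l hl
      have hl' : l + 1 < n i := by rw [hsub] at hl; omega
      have hal := neg_one_lt_add_nat (hα i) l
      rw [← weightedIntegralₗ_apply hal hβ, hRdef, map_sub, map_sub, map_sub, map_smul, map_sum]
      simp only [map_smul, weightedIntegralₗ_apply]
      rw [← pow_one X, weightedIntegral_X_pow_mul, add_assoc, ← Nat.cast_add,
        typeII_orthogonal hα hβ n hl', typeII_orthogonal hα hβ n (by omega),
        typeII_orthogonal hα hβ _ (show l < (n + Pi.single k 1 : Fin p → ℕ) i from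
          (show l < n i by omega).trans_le (hle i)), sum_eq_zero]
      · simp
      · intro j hj
        obtain ⟨hj1, hjp⟩ := mem_Icc.1 hj
        by_cases hjr : j ≤ r
        · rw [typeIISub_of_le ((hr j hjp).2 hjr), typeII_orthogonal hα hβ _
            (hl.trans_le (tsub_le_tsub_left (stepIndex_mono π hjr) n i)), smul_zero]
        · rw [typeIISub_of_not_le fun h => hjr ((hr j hjp).1 h), ← weightedIntegralₗ_apply hal hβ,
            map_zero, smul_zero]
  -- The form of `n - s_{t-1}` has length `deg R + 1`. It vanishes on `B_{n - s_j}` for `j < t` by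
  -- orthogonality and for `j > t` by degree, which leaves only `j = t`.
  · obtain ⟨t, ht1, htr, ht⟩ : ∃ t, 1 ≤ t ∧ t ≤ r ∧ len n = R.natDegree + t :=
      ⟨len n - R.natDegree, by omega, by omega, by omega⟩
    set m := n - stepIndex π (t - 1) with hm
    have hmlen : len m = R.natDegree + 1 := by rw [hlensub _ (by omega)]; omega
    refine hcoeff m hmlen ?_
    have hmn : m ≤ n := tsub_le_self
    rw [hform, typeIForm_typeII_of_le hα hβ (hmn.trans hle), typeIForm_typeII_of_le hα hβ hmn,
      sum_eq_single t]
    · rw [typeIISub_of_le ((hr t (by omega)).2 htr), typeIForm_typeII_of_len_lt hα hβ hαα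
        (by rw [hlensub t htr]; omega), if_pos (by rw [hlensub t htr]; omega)]
      simp [hb, hm]
    · intro j hj hjt
      obtain ⟨hj1, hjp⟩ := mem_Icc.1 hj
      by_cases hjr : j ≤ r
      · rw [typeIISub_of_le ((hr j hjp).2 hjr)]
        rcases hjt.lt_or_gt with h | h
        · rw [typeIForm_typeII_of_le hα hβ (tsub_le_tsub_left (stepIndex_mono π (by omega)) n),
            mul_zero]
        · rw [typeIForm_typeII_of_len_lt hα hβ hαα (by rw [hlensub j hjr]; omega),
            if_neg (by rw [hlensub j hjr]; omega), mul_zero]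
      · rw [typeIISub_of_not_le fun h => hjr ((hr j hjp).1 h), typeIForm_zero hα hβ, mul_zero]
    · intro h
      exact absurd (mem_Icc.2 ⟨ht1, htr.trans hrp⟩) h

/-- Dual argument: the remainder `V` fits `n + s_p`, so it suffices to pair it to zero with one
monic polynomial of each degree below `len n + p`. No ordering condition on `n` arises, since the
chain only goes upwards. -/
lemma typeI_recurrence (hα : ∀ i, -1 < α i) (hβ : -1 < β)
    (hαα : ∀ i j, i ≠ j → ∀ z : ℤ, α i - α j ≠ z) (π : Equiv.Perm (Fin p)) (n : Fin p → ℕ)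
    (k : Fin p) (hk : 1 ≤ n k) (i : Fin p) :
    X * typeI α β n i = typeI α β (n - Pi.single k 1) i +
      C (typeIForm α β n (X * typeII α β (n - Pi.single k 1))) * typeI α β n i +
      ∑ j ∈ Icc 1 p, C (typeIForm α β n (X * typeII α β (n + stepIndex π (j - 1)))) *
        typeI α β (n + stepIndex π j) i := by
  obtain ⟨m, rfl⟩ : ∃ m, n = m + Pi.single k 1 :=
    ⟨n - Pi.single k 1, (tsub_add_cancel_of_le fun q => by
      by_cases hq : q = k
      · subst hq; simpa using hk
      · simp [hq]).symm⟩
  rw [add_tsub_cancel_right]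
  set n := m + Pi.single k 1 with hn
  have hlen : len n = len m + 1 := len_add_single m k
  have hmn : m ≤ n := le_self_add
  have hlens : ∀ j ≤ p, len (n + stepIndex π j) = len m + 1 + j := fun j hj => by
    rw [len_add, hlen, len_stepIndex π hj]
  set b : ℕ → ℝ := fun j => typeIForm α β n (X * typeII α β (n + stepIndex π (j - 1))) with hb
  set b₀ := typeIForm α β n (X * typeII α β m) with hb₀
  set V : Fin p → ℝ[X] := (fun i => X * typeI α β n i) - typeI α β m - b₀ • typeI α β n -
    ∑ j ∈ Icc 1 p, b j • typeI α β (n + stepIndex π j) with hVdef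
  suffices hV : V = 0 by
    have hVi := congrFun hV i
    simp only [hVdef, Pi.sub_apply, Pi.smul_apply, Finset.sum_apply, Pi.zero_apply,
      smul_eq_C_mul] at hVi
    rw [sub_eq_zero, sub_eq_iff_eq_add, sub_eq_iff_eq_add] at hVi
    rw [hVi]
    ring
  have hform : ∀ f : ℝ[X], pairing hα hβ V f = typeIForm α β n (X * f) - typeIForm α β m f -
      b₀ * typeIForm α β n f - ∑ j ∈ Icc 1 p, b j * typeIForm α β (n + stepIndex π j) f := by
    intro f
    rw [hVdef]
    simp only [map_sub, map_smul, map_sum, LinearMap.sub_apply, LinearMap.smul_apply,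
      LinearMap.sum_apply, smul_eq_mul, pairing_X_mul, pairing_typeI]
  have hmono : ∀ {a c : ℕ}, a ≤ c → degreeLT ℝ a ≤ degreeLT ℝ c := fun h => degreeLT_mono h
  have hadd : ∀ j ≤ p, n + stepIndex π j ≤ n + stepIndex π p := fun j hj =>
    add_le_add_right (stepIndex_mono π hj) n
  have hp : ∀ q, (n + stepIndex π p) q = n q + 1 := fun q => by
    simp [stepIndex_apply]
  refine eq_zero_of_pairing_eq_zero hα hβ hαα (n := n + stepIndex π p) (fun q => ?_) fun f hf =>
    eq_zero_of_monic_basis (fun d hd => ?_) hf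
  · rw [hVdef]
    simp only [Pi.sub_apply, Pi.smul_apply, Finset.sum_apply]
    refine Submodule.sub_mem _ (Submodule.sub_mem _ (Submodule.sub_mem _ ?_ ?_)
      (Submodule.smul_mem _ _ ?_)) (Submodule.sum_mem _ fun j hj => Submodule.smul_mem _ _ ?_)
    · rw [hp, mem_degreeLT, degree_lt_iff_coeff_zero]
      intro l hl
      obtain ⟨l, rfl⟩ : ∃ l', l = l' + 1 := ⟨l - 1, by omega⟩
      rw [coeff_X_mul]
      exact (degree_lt_iff_coeff_zero _ _).1 (mem_degreeLT.1 (typeI_mem_degreeLT n q)) l (by omega)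
    · exact hmono ((hmn.trans (le_self_add (b := stepIndex π p))) q) (typeI_mem_degreeLT m q)
    · exact hmono (by rw [hp]; omega) (typeI_mem_degreeLT n q)
    · exact hmono (hadd j (mem_Icc.1 hj).2 q) (typeI_mem_degreeLT _ q)
  rw [hlens p le_rfl] at hd
  -- The test polynomials are `X ^ d`, then `B_m`, then `B_{n + s_t}`; the last two isolate `b₀` and
  -- `b (t + 1)`.
  rcases lt_trichotomy d (len m) with hdm | hdm | hdm
  · refine ⟨X ^ d, monic_X_pow d, natDegree_X_pow d, ?_⟩
    rw [hform, ← pow_succ', typeIForm_X_pow hα hβ hαα n (j := d + 1) (by omega),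
      typeIForm_X_pow hα hβ hαα m hdm, typeIForm_X_pow hα hβ hαα n (j := d) (by omega),
      if_neg (show ¬ d + 1 = len n by omega), sum_eq_zero]
    · simp [hlen]
    · intro j hj
      have hjl := hlens j (mem_Icc.1 hj).2
      rw [typeIForm_X_pow hα hβ hαα _ (by omega), if_neg (by omega), mul_zero]
  · refine ⟨typeII α β m, typeII_monic hα hβ m, by rw [typeII_natDegree hα hβ, hdm], ?_⟩
    rw [hform, typeIForm_typeII_of_le hα hβ le_rfl, typeIForm_typeII_of_len_lt hα hβ hαα
      (by omega), if_pos hlen.symm, sum_eq_zero]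
    · rw [hb₀]; ring
    · intro j hj
      have hjl := hlens j (mem_Icc.1 hj).2
      have := (mem_Icc.1 hj).1
      rw [typeIForm_typeII_of_len_lt hα hβ hαα (by omega), if_neg (by omega), mul_zero]
  · obtain ⟨t, ht⟩ : ∃ t, d = len m + 1 + t := ⟨d - (len m + 1), by omega⟩
    have htp : t < p := by omega
    set B := typeII α β (n + stepIndex π t) with hB
    have hle : n ≤ n + stepIndex π t := le_self_add
    refine ⟨B, typeII_monic hα hβ _, by rw [typeII_natDegree hα hβ, hlens t htp.le, ht], ?_⟩
    rw [hform, typeIForm_typeII_of_le hα hβ (hmn.trans hle), typeIForm_typeII_of_le hα hβ hle,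
      sum_eq_single (t + 1)]
    · rw [typeIForm_typeII_of_len_lt hα hβ hαα (by rw [hlens t htp.le, hlens _ htp]; omega),
        if_pos (by rw [hlens t htp.le, hlens _ htp]; omega)]
      simp [hb, hB]
    · intro j hj hjt
      obtain ⟨hj1, hjp⟩ := mem_Icc.1 hj
      rcases hjt.lt_or_gt with h | h
      · rw [typeIForm_typeII_of_le hα hβ (add_le_add_right (stepIndex_mono π (by omega)) n),
          mul_zero]
      · rw [typeIForm_typeII_of_len_lt hα hβ hαα (by rw [hlens t htp.le, hlens _ hjp]; omega),
          if_neg (by rw [hlens t htp.le, hlens _ hjp]; omega), mul_zero]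
    · intro h
      exact absurd (mem_Icc.2 ⟨by omega, htp⟩) h

end Recurrence

/-! ### Closed forms of the recurrence coefficients -/

section ClosedForm

variable {p : ℕ} {α : Fin p → ℝ} {β : ℝ}

lemma typeIForm_X_mul (m : Fin p → ℕ) (f : ℝ[X]) :
    typeIForm α β m (X * f) = ∑ i, ∑ l ∈ range (m i),
      typeICoeff α β m i l * weightedIntegral (α i + (l + 1 : ℕ)) β f := by
  rw [typeIForm, nodes, sum_sigma]
  refine sum_congr rfl fun i _ => sum_congr rfl fun l _ => ?_
  rw [← pow_one X, weightedIntegral_X_pow_mul]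
  push_cast
  rw [add_assoc]

/-- A summand of `∑_i ∫ x B_n A_m^{(i)} w_i dμ`, where `|m| + j = |n| + 1`. -/
lemma typeICoeff_mul_weightedIntegral (hα : ∀ i, -1 < α i) (hβ : -1 < β)
    (hαα : ∀ i j, i ≠ j → ∀ z : ℤ, α i - α j ≠ z) {m n : Fin p → ℕ} {j : ℕ}
    (hmn : len m + j = len n + 1) {i : Fin p} {l : ℕ} (hl : l < m i) :
    typeICoeff α β m i l * weightedIntegral (α i + (l + 1 : ℕ)) β (typeII α β n) =
      (α i + l + 1) * (poch (β + len m) j / poch (α i + l + β + len m + 1) (j + 1)) *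
      ((∏ x ∈ (nodes m).erase ⟨i, l⟩, (β + len m + (α x.1 + x.2))) /
        ∏ q, poch (α q + β + len n + 1) (n q)) *
      ((∏ q, ∏ c ∈ range (n q), (α i + l + 1 - (α q + c))) /
        ∏ x ∈ (nodes m).erase ⟨i, l⟩, (α i + l - (α x.1 + x.2))) := by
  obtain ⟨K, hK⟩ : ∃ K, len m = K + 1 :=
    ⟨len m - 1, by have := (Nat.zero_lt_of_lt hl).trans_le (le_len m i); omega⟩
  have hKN : K + j = len n := by omega
  have ht := neg_one_lt_add_nat (hα i) l
  have hK0 : (0 : ℝ) ≤ K := K.cast_nonneg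
  have hsign : ∀ k : ℕ, ((-1 : ℝ) ^ k) * (-1) ^ k = 1 := fun k => by rw [← mul_pow]; simp
  have hmem : (⟨i, l⟩ : Σ _ : Fin p, ℕ) ∈ nodes m := mem_nodes.2 hl
  have e1 : ∏ x ∈ (nodes m).erase ⟨i, l⟩, (-β - len m - (α x.1 + x.2)) =
      (-1) ^ K * ∏ x ∈ (nodes m).erase ⟨i, l⟩, (β + len m + (α x.1 + x.2)) := by
    have hc : #((nodes m).erase ⟨i, l⟩) = K := by
      rw [card_erase_of_mem hmem, card_nodes, hK, Nat.add_sub_cancel]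
    rw [← hc, ← prod_const, ← prod_mul_distrib]
    exact prod_congr rfl fun x _ => by ring
  have e2 : ∏ q, poch (α q - (α i + (l + 1 : ℕ))) (n q) =
      (-1) ^ len n * ∏ q, ∏ c ∈ range (n q), (α i + l + 1 - (α q + c)) := by
    rw [len, ← prod_pow_eq_pow_sum, ← prod_mul_distrib]
    refine prod_congr rfl fun q _ => ?_
    have := prod_neg_sub_eq_poch (α q - (α i + (l + 1 : ℕ))) (n q)
    calc _ = (-1) ^ n q * ((-1) ^ n q * poch (α q - (α i + (l + 1 : ℕ))) (n q)) := by
          rw [← mul_assoc, hsign, one_mul]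
      _ = _ := by
          rw [← this]
          congr 1
          exact prod_congr rfl fun c _ => by push_cast; ring
  have g1 : Real.Gamma (α i + (l + 1 : ℕ) + 1) =
      (α i + l + 1) * Real.Gamma (α i + l + 1) := by
    rw [← Real.Gamma_add_one (by linarith)]; push_cast; ring_nf
  have g2 : Real.Gamma (α i + (l + 1 : ℕ) + β + len n + 2) =
      poch (α i + l + β + len m + 1) (j + 1) * Real.Gamma (α i + l + β + len m + 1) := by
    rw [← Gamma_add_nat (by rw [hK]; push_cast; linarith), hK, ← hKN]; push_cast; ring_nf
  have g3 : Real.Gamma (β + len m) = poch (β + 1) K * Real.Gamma (β + 1) := by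
    rw [← Gamma_add_nat (by linarith), hK]; push_cast; ring_nf
  have g4 : poch (β + 1) (len n) = poch (β + 1) K * poch (β + len m) j := by
    rw [← hKN, poch_add, hK]; push_cast; ring_nf
  have n1 := (Real.Gamma_pos_of_pos (show 0 < α i + l + 1 by linarith)).ne'
  have n2 := (Real.Gamma_pos_of_pos (show 0 < β + 1 by linarith)).ne'
  have n3 := (Real.Gamma_pos_of_pos (show 0 < α i + l + β + len m + 1 by
    rw [hK]; push_cast; linarith)).ne'
  have n4 := (poch_pos (show 0 < β + 1 by linarith) K).ne'
  have n5 := (poch_pos (show 0 < α i + l + β + len m + 1 by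
    rw [hK]; push_cast; linarith) (j + 1)).ne'
  rw [typeICoeff_eq hα hβ hαα m hl, weightedIntegral_typeII hα hβ (neg_one_lt_add_nat (hα i) _),
    prod_div_distrib, prod_div_distrib, e1, e2, g1, g2, g3, g4, hK, Nat.add_sub_cancel, ← hK]
  set P₁ := ∏ x ∈ (nodes m).erase ⟨i, l⟩, (β + len m + (α x.1 + x.2))
  set P₂ := ∏ x ∈ (nodes m).erase ⟨i, l⟩, (α i + l - (α x.1 + x.2))
  set P₃ := ∏ q, ∏ c ∈ range (n q), (α i + l + 1 - (α q + c))
  set P₄ := ∏ q, poch (α q + β + len n + 1) (n q)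
  calc _ = ((-1) ^ K * (-1) ^ K) * ((-1) ^ len n * (-1) ^ len n) *
        (Real.Gamma (α i + l + β + len m + 1) /
          (Real.Gamma (α i + l + 1) * (poch (β + 1) K * Real.Gamma (β + 1))) *
          ((α i + l + 1) * Real.Gamma (α i + l + 1) * Real.Gamma (β + 1) /
            (poch (α i + l + β + len m + 1) (j + 1) * Real.Gamma (α i + l + β + len m + 1))) *
          (poch (β + 1) K * poch (β + len m) j)) * (P₁ / P₄) * (P₃ / P₂) := by
        simp only [div_eq_mul_inv, mul_inv]
        ring
    _ = _ := by
        rw [hsign, hsign]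
        congr 2
        field_simp

lemma prod_range_shift (u : ℝ) (n : ℕ) :
    ∏ c ∈ range (n + 1), (u + 1 - c) = (u + 1) * ∏ c ∈ range n, (u - c) := by
  rw [prod_range_succ', mul_comm]
  congr 1
  · simp
  · exact prod_congr rfl fun c _ => by push_cast; ring

lemma prod_range_shift_div {u : ℝ} {n : ℕ} (hu : ∀ c < n, u - c ≠ 0) (hu' : u + 1 - n ≠ 0) :
    (∏ c ∈ range n, (u + 1 - c)) / ∏ c ∈ range n, (u - c) = (u + 1) / (u + 1 - n) := by
  have h := prod_range_shift u n
  rw [prod_range_succ] at h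
  rw [div_eq_div_iff (prod_ne_zero_iff.2 fun c hc => hu c (mem_range.1 hc)) hu', h]

lemma sub_add_int_ne_zero (hαα : ∀ i j, i ≠ j → ∀ z : ℤ, α i - α j ≠ z) {i q : Fin p}
    (h : i ≠ q) (z : ℤ) : α i - α q + z ≠ 0 := fun hz =>
  hαα i q h (-z) (by push_cast; linarith)

/-- The ratio of the products over nodes, for a multi-index `m` obtained from `n` by lowering some
entries by one. -/
lemma prod_shift_div_prod_nodes (hαα : ∀ i j, i ≠ j → ∀ z : ℤ, α i - α j ≠ z) {m n : Fin p → ℕ}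
    (hmn : ∀ q, m q = n q ∨ n q = m q + 1) {i : Fin p} {l : ℕ} (hm : m i = l + 1)
    (hn : n i = l + 1) :
    (∏ q, ∏ c ∈ range (n q), (α i + l + 1 - (α q + c))) /
        ∏ x ∈ (nodes m).erase ⟨i, l⟩, (α i + l - (α x.1 + x.2)) =
      (∏ q, (α i - α q + n i)) /
        ∏ q ∈ (univ.erase i).filter (fun q => m q = n q), (α i - α q + n i - n q) := by
  have hi : ∏ c ∈ range (n i), (α i + l + 1 - (α i + c)) =
      (α i - α i + n i) * ∏ c ∈ range l, (α i + l - (α i + c)) := by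
    have h1 := prod_range_shift l l
    rw [hn, show ∏ c ∈ range l, (α i + l - (α i + c)) = ∏ c ∈ range l, ((l : ℝ) - c) from
      prod_congr rfl fun c _ => by ring, sub_self, zero_add, Nat.cast_succ, ← h1]
    exact prod_congr rfl fun c _ => by ring
  have hi0 : ∏ c ∈ range l, (α i + l - (α i + c)) ≠ 0 := prod_ne_zero_iff.2 fun c hc => by
    have : (c : ℝ) < l := by exact_mod_cast mem_range.1 hc
    intro h
    linarith
  -- Telescoping: an unchanged entry leaves the first numerator factor over the last denominator
  -- factor; a lowered entry leaves only the first numerator factor.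
  have hq : ∀ q ∈ univ.erase i, (∏ c ∈ range (n q), (α i + l + 1 - (α q + c))) /
      ∏ c ∈ range (m q), (α i + l - (α q + c)) =
      (α i - α q + n i) / if m q = n q then (α i - α q + n i - n q) else 1 := by
    intro q hq
    have hne := sub_add_int_ne_zero hαα (ne_of_mem_erase hq).symm
    have e1 : ∀ k : ℕ, ∏ c ∈ range k, (α i + l + 1 - (α q + c)) =
        ∏ c ∈ range k, (α i - α q + l + 1 - c) := fun k => prod_congr rfl fun c _ => by ring
    have e2 : ∀ k : ℕ, ∏ c ∈ range k, (α i + l - (α q + c)) =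
        ∏ c ∈ range k, (α i - α q + l - c) := fun k => prod_congr rfl fun c _ => by ring
    have hne' : ∀ c : ℕ, α i - α q + l - c ≠ 0 := fun c h => hne (l - c) (by push_cast; linarith)
    rw [e1, e2, hn, Nat.cast_succ, ← add_assoc]
    split_ifs with h
    · rw [h, prod_range_shift_div (fun c _ => hne' c)]
      intro h'
      exact hne (l + 1 - n q) (by push_cast; linarith)
    · rw [(hmn q).resolve_left h, prod_range_shift, div_one,
        mul_div_cancel_right₀ _ (prod_ne_zero_iff.2 fun c _ => hne' c)]
  rw [prod_nodes_erase, hm, range_add_one, erase_insert (by simp),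
    ← mul_prod_erase univ _ (mem_univ i), hi, ← mul_prod_erase univ _ (mem_univ i), prod_filter,
    mul_div_assoc (α i - α i + (n i : ℝ)) _ (∏ a ∈ univ.erase i, ite _ _ _), ← prod_div_distrib,
    ← prod_congr rfl hq, prod_div_distrib]
  field_simp

/-- A summand of the closed form of `b_n^j`, where `m = n - s_{j-1}`, written without the
removable singularities in `β`. -/
noncomputable def regularTerm (α : Fin p → ℝ) (β : ℝ) (m n : Fin p → ℕ) (j : ℕ) (i : Fin p) : ℝ :=
  (α i + n i) * (poch (β + len m) j / poch (α i + n i + β + len m) (j + 1)) *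
    (((∏ q ∈ univ.erase i, poch (α q + β + len m) (m q)) * poch (α i + β + len m) (n i - 1)) /
      ∏ q, poch (α q + β + len n + 1) (n q)) *
    ((∏ q, (α i - α q + n i)) /
      ∏ q ∈ (univ.erase i).filter (fun q => m q = n q), (α i - α q + n i - n q))

lemma prod_sub_add_eq_zero {n : Fin p → ℕ} {i : Fin p} (hi : n i = 0) :
    ∏ q, (α i - α q + n i) = 0 :=
  prod_eq_zero (mem_univ i) (by simp [hi])

lemma regularTerm_eq_zero (m : Fin p → ℕ) {n : Fin p → ℕ} (j : ℕ) {i : Fin p} (hi : n i = 0) :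
    regularTerm α β m n j i = 0 := by
  rw [regularTerm, prod_sub_add_eq_zero hi, zero_div, mul_zero]

/-- `X * typeII α β n` is orthogonal at `α i + l` whenever `l + 1 < n i`. So only `l = n i - 1` can
contribute, and it is a node of `m` exactly when `m i = n i > 0`. -/
lemma typeIForm_X_mul_typeII (hα : ∀ i, -1 < α i) (hβ : -1 < β)
    (hαα : ∀ i j, i ≠ j → ∀ z : ℤ, α i - α j ≠ z) {m n : Fin p → ℕ} {j : ℕ}
    (hlen : len m + j = len n + 1) (hmn : ∀ q, m q = n q ∨ n q = m q + 1) :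
    typeIForm α β m (X * typeII α β n) =
      ∑ i ∈ univ.filter (fun i => m i = n i), regularTerm α β m n j i := by
  rw [typeIForm_X_mul, sum_filter]
  refine sum_congr rfl fun i _ => ?_
  split_ifs with h
  · rcases Nat.eq_zero_or_eq_succ_pred (n i) with h0 | h0
    · rw [regularTerm_eq_zero m j h0, h, h0, range_zero, sum_empty]
    · obtain ⟨l, hl⟩ : ∃ l, n i = l + 1 := ⟨_, h0⟩
      have hml : m i = l + 1 := h.trans hl
      rw [hml, sum_range_succ, sum_eq_zero, zero_add,
        typeICoeff_mul_weightedIntegral hα hβ hαα hlen (by omega),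
        prod_shift_div_prod_nodes hαα hmn hml hl, regularTerm]
      · have e : ∀ q k, ∏ c ∈ range k, (β + len m + (α q + c)) = poch (α q + β + len m) k := by
          intro q k
          rw [poch_eq_prod]
          exact prod_congr rfl fun c _ => by ring
        rw [prod_nodes_erase, hml, range_add_one, erase_insert (by simp), hl, Nat.add_sub_cancel,
          prod_congr rfl fun q _ => e q (m q), e, Nat.cast_succ, add_assoc (α i) (l : ℝ) 1,
          show α i + l + β + len m + 1 = α i + (l + 1) + β + len m by ring]
      · intro c hc
        rw [typeII_orthogonal hα hβ n (by rw [hl]; simpa using hc), mul_zero]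
  · refine sum_eq_zero fun l hl => ?_
    rw [typeII_orthogonal hα hβ n, mul_zero]
    have := (hmn i).resolve_left h
    have := mem_range.1 hl
    omega

/-- If `n i ≥ 1` and `len m ≥ 1`, every denominator involving `β` is positive; if `n i = 0`, the
term is identically zero. -/
lemma continuousAt_regularTerm (hα : ∀ i, -1 < α i) (hβ : -1 < β) (m n : Fin p → ℕ)
    (j : ℕ) (i : Fin p) (hm : 1 ≤ len m) :
    ContinuousAt (fun β => regularTerm α β m n j i) β := by
  rcases Nat.eq_zero_or_pos (n i) with hi | hi
  · simp only [regularTerm_eq_zero m j hi]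
    exact continuousAt_const
  have hc : ∀ (f : ℝ → ℝ), Continuous f → ∀ k, ContinuousAt (fun β => poch (f β) k) β :=
    fun f hf k => ((continuous_poch k).comp hf).continuousAt
  have h1 : (1 : ℝ) ≤ n i := by exact_mod_cast hi
  have h2 : (1 : ℝ) ≤ len m := by exact_mod_cast hm
  unfold regularTerm
  refine ContinuousAt.mul (ContinuousAt.mul (ContinuousAt.mul continuousAt_const
    (ContinuousAt.div (hc _ (by fun_prop) _) (hc _ (by fun_prop) _) ?_))
    (ContinuousAt.div (ContinuousAt.mul ((continuous_finsetProd _ fun q _ =>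
      (continuous_poch _).comp (by fun_prop)).continuousAt)
      (hc _ (by fun_prop) _)) ((continuous_finsetProd _ fun q _ =>
      (continuous_poch _).comp (by fun_prop)).continuousAt) ?_))
    continuousAt_const
  · exact (poch_pos (by linarith [hα i]) _).ne'
  · exact (prod_pos fun q _ => poch_add_len_pos hα hβ n q).ne'

lemma poch_div_poch_comm {x : ℝ} {j n : ℕ} (h1 : poch (x + n) j ≠ 0) (h2 : poch (x + j) n ≠ 0) :
    poch x j / poch (x + n) j = poch x n / poch (x + j) n := by
  rw [div_eq_div_iff h1 h2, ← poch_add, ← poch_add, add_comm]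

/-- The two differ by factors built from `y q + c` with `c` a natural number and `y q = α q + β +
len m > -1`. Only `y q = 0` could spoil their cancellation, and that requires `len m = 1` and `α q +
β = -1`. -/
lemma coeffPos_eq_sum_regularTerm (hα : ∀ i, -1 < α i) (hβ : -1 < β) (π : Equiv.Perm (Fin p))
    {m n : Fin p → ℕ} {j : ℕ} (hlen : len m + j = len n + 1) (hm : 1 ≤ len m)
    (hmn : ∀ q, m q = n q ∨ n q = m q + 1) (hS : ∀ q, q ∈ indexSet π j ↔ m q = n q)
    (hne : len m = 1 → ∀ q, α q + β ≠ -1) :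
    coeffPos α β π n j = ∑ i ∈ univ.filter (fun i => m i = n i), regularTerm α β m n j i := by
  have hSeq : indexSet π j = univ.filter (fun i => m i = n i) := by ext q; simp [hS]
  have hK : (len n : ℝ) - j + 1 = len m := by
    have : (len m : ℝ) + j = len n + 1 := by exact_mod_cast hlen
    linarith
  have hm1 : (1 : ℝ) ≤ len m := by exact_mod_cast hm
  set y : Fin p → ℝ := fun q => α q + β + len m with hy
  have hy0 : ∀ q, y q ≠ 0 := by
    intro q h
    rcases hm.eq_or_lt with h1 | h1
    · refine hne h1.symm q ?_
      simp only [hy, ← h1] at h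
      push_cast at h
      linarith
    · have : (2 : ℝ) ≤ len m := by exact_mod_cast h1
      simp only [hy] at h
      linarith [hα q]
  have hyp : ∀ q, -1 < y q := fun q => by simp only [hy]; linarith [hα q]
  have hynat : ∀ (q : Fin p) (k : ℕ), y q + k ≠ 0 := by
    intro q k
    rcases Nat.eq_zero_or_pos k with rfl | hk
    · simpa using hy0 q
    · have : (1 : ℝ) ≤ k := by exact_mod_cast hk
      have := hyp q
      intro h
      linarith
  have hpoch : ∀ (q : Fin p) (a k : ℕ), poch (y q + a) k ≠ 0 := fun q a k =>
    poch_ne_zero fun c _ h => hynat q (a + c) (by push_cast; linarith)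
  rw [coeffPos, mul_sum, hSeq]
  refine sum_congr rfl fun i hi => ?_
  have hi : m i = n i := (mem_filter.1 hi).2
  rcases Nat.eq_zero_or_eq_succ_pred (n i) with h0 | h0
  · rw [regularTerm_eq_zero m j h0, prod_sub_add_eq_zero h0]
    simp
  obtain ⟨l, hl⟩ : ∃ l, n i = l + 1 := ⟨_, h0⟩
  have hprod : ∏ q, poch (y q) (n q) = (∏ q ∈ univ.erase i, poch (y q) (m q)) * poch (y i) l *
      (y i + l) * ∏ q ∈ (univ.filter (fun i => m i = n i))ᶜ, (α q + β + len n - j + n q) := by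
    have h1 : ∀ q, poch (y q) (n q) =
        poch (y q) (m q) * if ¬ m q = n q then (α q + β + len n - j + n q) else 1 := by
      intro q
      split_ifs with h
      · rw [h, mul_one]
      · rw [(hmn q).resolve_left h, poch_succ]
        simp only [hy, ← hK]
        push_cast
        ring_nf
    rw [prod_congr rfl fun q _ => h1 q, prod_mul_distrib, ← prod_filter, compl_filter,
      ← prod_erase_mul univ _ (mem_univ i), hi, hl, poch_succ]
    ring
  have hA : ∏ q, poch (α q + β + len n - j + 1) j / poch (α q + β + len n - j + n q + 1) j =
      (∏ q, poch (y q) (n q)) / ∏ q, poch (α q + β + len n + 1) (n q) := by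
    rw [← prod_div_distrib]
    refine prod_congr rfl fun q _ => ?_
    rw [show α q + β + len n - j + 1 = y q by simp only [hy, ← hK]; ring,
      show α q + β + len n - j + n q + 1 = y q + n q by simp only [hy, ← hK]; ring,
      show α q + β + len n + 1 = y q + j by simp only [hy, ← hK]; ring,
      poch_div_poch_comm (hpoch q _ _) (hpoch q _ _)]
  have hB : poch (α i + β + n i + len n - j) (j + 2) =
      (y i + l) * poch (α i + n i + β + len m) (j + 1) := by
    rw [show j + 2 = j + 1 + 1 by ring, poch_succ_left, ← hK, hl]
    simp only [hy, ← hK]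
    push_cast
    ring_nf
  have hCne : ∏ q ∈ (univ.filter (fun i => m i = n i))ᶜ, (α q + β + len n - j + n q) ≠ 0 := by
    refine prod_ne_zero_iff.2 fun q hq h => hynat q (m q) ?_
    have hq : n q = m q + 1 := (hmn q).resolve_left (by simpa using hq)
    rw [hq] at h
    simp only [hy, ← hK]
    push_cast at h ⊢
    linarith
  have hD : (univ.filter (fun i => m i = n i)).erase i =
      (univ.erase i).filter (fun q => m q = n q) := by
    ext q; simp [and_comm]
  rw [hA, hprod, hB, hD, regularTerm, show β + len n - j + 1 = β + len m by rw [← hK]; ring, hl,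
    Nat.add_sub_cancel]
  have n1 := hynat i l
  set Q := ∏ q ∈ (univ.filter (fun i => m i = n i))ᶜ, (α q + β + len n - j + n q)
  set P₁ := ∏ q ∈ univ.erase i, poch (y q) (m q)
  set P₂ := poch (y i) l
  -- This quotient is the whole discrepancy between the closed form and the regular term.
  have hcancel : (y i + l) * Q / ((y i + l) * Q) = 1 := div_self (mul_ne_zero n1 hCne)
  simp only [div_eq_mul_inv, mul_inv] at hcancel ⊢
  linear_combination (poch (β + len m) j * (P₁ * P₂ * (∏ q, poch (α q + β + len n + 1) (n q))⁻¹) *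
    ((α i + (l + 1 : ℕ)) * (poch (α i + (l + 1 : ℕ) + β + len m) (j + 1))⁻¹) *
    ((∏ q, (α i - α q + (l + 1 : ℕ))) *
      (∏ q ∈ (univ.erase i).filter (fun q => m q = n q), (α i - α q + (l + 1 : ℕ) - n q))⁻¹)) *
    hcancel

/-- The nodes of `n + e_k` are those of `n` and the new node `(k, n k)`. The new node gives the
first summand of `coeffZero`; among the old ones only the last node of each index survives and gives
the sum. -/
lemma typeIForm_add_single (hα : ∀ i, -1 < α i) (hβ : -1 < β)
    (hαα : ∀ i j, i ≠ j → ∀ z : ℤ, α i - α j ≠ z) (n : Fin p → ℕ) (k : Fin p) :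
    typeIForm α β (n + Pi.single k 1) (X * typeII α β n) = coeffZero α β n k := by
  set m : Fin p → ℕ := n + Pi.single k 1 with hm
  have hmk : m k = n k + 1 := by simp [hm]
  have hmq : ∀ q, q ≠ k → m q = n q := fun q hq => by simp [hm, hq]
  have hlen : len m + 0 = len n + 1 := len_add_single n k
  have hlenR : (len m : ℝ) = len n + 1 := by exact_mod_cast hlen
  have hnodes : nodes m = insert ⟨k, n k⟩ (nodes n) := by
    ext ⟨q, c⟩
    by_cases hq : q = k
    · subst hq
      simp [mem_nodes, hmk]
      omega
    · simp [mem_nodes, hmq q hq, hq]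
  have hnot : (⟨k, n k⟩ : Σ _ : Fin p, ℕ) ∉ nodes n := by simp [mem_nodes]
  have hall : ∏ x ∈ nodes n, (β + len m + (α x.1 + x.2)) =
      ∏ q, poch (α q + β + len n + 1) (n q) := by
    rw [nodes, prod_sigma]
    refine prod_congr rfl fun q _ => ?_
    rw [poch_eq_prod, hlenR]
    exact prod_congr rfl fun c _ => by ring
  have hall0 : ∏ q, poch (α q + β + len n + 1) (n q) ≠ 0 :=
    (prod_pos fun q _ => poch_add_len_pos hα hβ n q).ne'
  have hsum : typeIForm α β m (X * typeII α β n) =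
      typeICoeff α β m k (n k) * weightedIntegral (α k + (n k + 1 : ℕ)) β (typeII α β n) +
      ∑ i, ∑ l ∈ range (n i),
        typeICoeff α β m i l * weightedIntegral (α i + (l + 1 : ℕ)) β (typeII α β n) := by
    rw [typeIForm_X_mul, sum_sigma' univ (fun i => range (m i)) (fun i l =>
      typeICoeff α β m i l * weightedIntegral (α i + (l + 1 : ℕ)) β (typeII α β n)),
      sum_sigma' univ (fun i => range (n i)) (fun i l =>
      typeICoeff α β m i l * weightedIntegral (α i + (l + 1 : ℕ)) β (typeII α β n))]
    rw [← nodes, ← nodes, hnodes, sum_insert hnot]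
  rw [hsum, coeffZero]
  congr 1
  · rw [typeICoeff_mul_weightedIntegral hα hβ hαα hlen (by omega), hnodes, erase_insert hnot,
      hall, div_self hall0, nodes, prod_sigma, ← prod_div_distrib, hlenR]
    simp only [poch_zero, zero_add, poch_one, mul_one, mul_one_div]
    congr 1
    · ring_nf
    · refine prod_congr rfl fun q _ => ?_
      have e1 : ∏ c ∈ range (n q), (α k + n k + 1 - (α q + c)) =
        ∏ c ∈ range (n q), (α k - α q + n k + 1 - c) := prod_congr rfl fun c _ => by ring
      have e2 : ∏ c ∈ range (n q), (α k + n k - (α q + c)) =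
        ∏ c ∈ range (n q), (α k - α q + n k - c) := prod_congr rfl fun c _ => by ring
      rw [e1, e2]
      by_cases hq : k = q
      · subst hq
        refine prod_range_shift_div (fun c hc h => ?_) (by ring_nf; exact one_ne_zero)
        have : (c : ℝ) < n k := by exact_mod_cast hc
        linarith
      · have hne := sub_add_int_ne_zero hαα hq
        refine prod_range_shift_div (fun c _ h => ?_) fun h => ?_
        · exact hne (n k - c) (by push_cast; linarith)
        · exact hne (n k + 1 - n q) (by push_cast; linarith)
  · refine sum_congr rfl fun i _ => ?_
    rcases Nat.eq_zero_or_eq_succ_pred (n i) with h0 | h0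
    · rw [prod_sub_add_eq_zero h0, h0]
      simp
    obtain ⟨l, hl⟩ : ∃ l, n i = l + 1 := ⟨_, h0⟩
    have hmem : (⟨i, l⟩ : Σ _ : Fin p, ℕ) ∈ nodes n := mem_nodes.2 (by simp [hl])
    have hlm : l < m i := by
      have : n i ≤ m i := le_self_add (a := n) (b := Pi.single k 1) i
      omega
    have hneq : (⟨k, n k⟩ : Σ _ : Fin p, ℕ) ≠ ⟨i, l⟩ := fun h => hnot (h ▸ hmem)
    have herase : (nodes m).erase ⟨i, l⟩ = insert ⟨k, n k⟩ ((nodes n).erase ⟨i, l⟩) := by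
      rw [hnodes, erase_insert_of_ne hneq]
    have hnot' : (⟨k, n k⟩ : Σ _ : Fin p, ℕ) ∉ (nodes n).erase ⟨i, l⟩ :=
      fun h => hnot (mem_of_mem_erase h)
    -- Separating the new node from both products produces the factors `α_k+β+n_k+|n|+1` and
    -- `α_i-α_k-n_k+n_i-1`.
    rw [hl, sum_range_succ, sum_eq_zero, zero_add,
      typeICoeff_mul_weightedIntegral hα hβ hαα hlen hlm, herase, prod_insert hnot',
      prod_insert hnot', mul_comm (α i + l - (α k + n k)), ← div_div,
      prod_shift_div_prod_nodes hαα (fun q => Or.inl rfl) hl hl]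
    · have hfil : (univ.erase i).filter (fun q => n q = n q) = univ.erase i := by simp
      have h3 : (1 : ℝ) ≤ len n := by exact_mod_cast (show 1 ≤ n i by omega).trans (le_len n i)
      have n1 : β + len m + (α i + l) ≠ 0 := by
        have h2 : (0 : ℝ) ≤ l := l.cast_nonneg
        have := hα i
        rw [hlenR]
        intro h
        linarith
      have hP := mul_prod_erase (nodes n) (fun x => β + len m + (α x.1 + x.2)) hmem
      rw [hall] at hP
      have hP' : ∏ x ∈ (nodes n).erase ⟨i, l⟩, (β + len m + (α x.1 + x.2)) =
          (∏ q, poch (α q + β + len n + 1) (n q)) / (β + len m + (α i + l)) := by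
        rw [eq_div_iff n1, ← hP, mul_comm]
      have hp2 : poch (α i + β + (l + 1 : ℕ) + len n) 2 =
          (β + len m + (α i + l)) * (α i + l + β + len m + 1) := by
        rw [poch_succ, poch_one, hlenR]; push_cast; ring
      rw [hfil, hP', hp2, poch_zero, zero_add, poch_one, hl,
        show α i - α k - n k + (l + 1 : ℕ) - 1 = α i + l - (α k + n k) by push_cast; ring,
        show β + len m + (α k + n k) = α k + β + n k + len n + 1 by rw [hlenR]; ring]
      have hc : (∏ q, poch (α q + β + len n + 1) (n q)) *
        (∏ q, poch (α q + β + len n + 1) (n q))⁻¹ = 1 := mul_inv_cancel₀ hall0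
      simp only [div_eq_mul_inv, mul_inv]
      push_cast
      linear_combination ((α i + l + 1) * (α i + l + β + len m + 1)⁻¹ *
        (α k + β + n k + len n + 1) * (β + len m + (α i + l))⁻¹ * (α i + l - (α k + n k))⁻¹ *
        (∏ q, (α i - α q + (l + 1))) *
        (∏ q ∈ univ.erase i, (α i - α q + (l + 1) - n q))⁻¹) * hc
    · intro c hc
      rw [typeII_orthogonal hα hβ n (by rw [hl]; simpa using hc), mul_zero]

end ClosedForm

/-! ### Closed forms by continuity, and assembly of the theorem -/

section Main

variable {p : ℕ} {α : Fin p → ℝ} {β : ℝ}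

lemma mem_indexSet_iff (π : Equiv.Perm (Fin p)) {n : Fin p → ℕ} {j : ℕ} (hj : 1 ≤ j)
    (hn : stepIndex π (j - 1) ≤ n) (q : Fin p) :
    q ∈ indexSet π j ↔ (n - stepIndex π (j - 1)) q = n q := by
  have h : (if (π.symm q : ℕ) < j - 1 then 1 else 0) ≤ n q := stepIndex_apply π _ q ▸ hn q
  rw [indexSet, mem_filter, Pi.sub_apply, stepIndex_apply]
  simp only [mem_univ, true_and]
  split_ifs at h ⊢ <;> constructor <;> intro <;> omega

lemma sub_stepIndex_eq_or (π : Equiv.Perm (Fin p)) {n : Fin p → ℕ} {j : ℕ}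
    (hn : stepIndex π j ≤ n) (q : Fin p) :
    (n - stepIndex π j) q = n q ∨ n q = (n - stepIndex π j) q + 1 := by
  have h : (if (π.symm q : ℕ) < j then 1 else 0) ≤ n q := stepIndex_apply π _ q ▸ hn q
  rw [Pi.sub_apply, stepIndex_apply]
  split_ifs at h ⊢ <;> omega

/-- The sum of regular terms is continuous in `β`, and it agrees with the closed form on a punctured
neighbourhood because the exceptional values `-1 - α q` are finite in number. -/
lemma closedForm (hα : ∀ i, -1 < α i) (hβ : -1 < β)
    (hαα : ∀ i j, i ≠ j → ∀ z : ℤ, α i - α j ≠ z) (π : Equiv.Perm (Fin p)) (n : Fin p → ℕ) {j : ℕ}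
    (hj : 1 ≤ j) (hjp : j ≤ p) (hn : stepIndex π (j - 1) ≤ n) (hjn : j ≤ len n) :
    ((len n = j → ∀ q, α q + β ≠ -1) →
      typeIForm α β (n - stepIndex π (j - 1)) (X * typeII α β n) = coeffPos α β π n j) ∧
    Filter.Tendsto (fun β' : ℝ => coeffPos α β' π n j) (nhdsWithin β {β}ᶜ)
      (nhds (typeIForm α β (n - stepIndex π (j - 1)) (X * typeII α β n))) := by
  have hS := mem_indexSet_iff π hj hn
  have hmn := sub_stepIndex_eq_or π hn
  have hlen := len_sub hn
  rw [len_stepIndex π (by omega)] at hlen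
  set m := n - stepIndex π (j - 1)
  have hlen' : len m + j = len n + 1 := by omega
  have hm : 1 ≤ len m := by omega
  rw [typeIForm_X_mul_typeII hα hβ hαα hlen' hmn]
  refine ⟨fun h => (coeffPos_eq_sum_regularTerm hα hβ π hlen' hm hmn hS fun h1 =>
    h (by omega)).symm, ?_⟩
  have hcont : ContinuousAt (fun β => ∑ i ∈ univ.filter (fun i => m i = n i),
      regularTerm α β m n j i) β :=
    tendsto_finsetSum _ fun i _ => continuousAt_regularTerm hα hβ m n j i hm
  refine (hcont.tendsto.mono_left nhdsWithin_le_nhds).congr' ?_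
  have h1 : ∀ᶠ β' in nhdsWithin β {β}ᶜ, -1 < β' :=
    nhdsWithin_le_nhds (lt_mem_nhds hβ)
  have h2 : ∀ᶠ β' in nhdsWithin β {β}ᶜ, ∀ q, α q + β' ≠ -1 := by
    refine Filter.eventually_all.2 fun q => ?_
    by_cases hq : α q + β = -1
    · filter_upwards [self_mem_nhdsWithin] with β' hβ' h
      exact hβ' (show β' = β by linarith)
    · refine nhdsWithin_le_nhds ?_
      exact (show ContinuousAt (fun β' => α q + β') β by fun_prop).eventually_ne hq
  filter_upwards [h1, h2] with β' h1 h2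
  exact (coeffPos_eq_sum_regularTerm hα h1 π hlen' hm hmn hS fun _ => h2).symm

end Main

end JacobiPineiro

theorem mainTheorem1 (p : ℕ) (α : Fin p → ℝ) (β : ℝ)
    (hα : ∀ i, -1 < α i) (hβ : -1 < β)
    (hαα : ∀ i j, i ≠ j → ∀ z : ℤ, α i - α j ≠ z) :
    -- the explicit polynomials are the multiple orthogonal polynomials of type II and of type I
    (∀ (n : Fin p → ℕ) (B : Polynomial ℝ),
      JacobiPineiro.IsTypeII α β n B ↔ B = JacobiPineiro.typeII α β n) ∧
    (∀ (n : Fin p → ℕ) (A : Fin p → Polynomial ℝ),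
      JacobiPineiro.IsTypeI α β n A ↔ A = JacobiPineiro.typeI α β n) ∧
    ∃ b : Equiv.Perm (Fin p) → (Fin p → ℕ) → ℕ → ℝ,
      -- the coefficients `b_n^j` are given by the closed form
      (∀ (π : Equiv.Perm (Fin p)) (n : Fin p → ℕ) (j : ℕ), 1 ≤ j → j ≤ p →
        JacobiPineiro.stepIndex π (j - 1) ≤ n → j ≤ JacobiPineiro.len n →
        ((JacobiPineiro.len n = j → ∀ q, α q + β ≠ -1) →
          b π n j = JacobiPineiro.coeffPos α β π n j) ∧
        Filter.Tendsto (fun β' : ℝ => JacobiPineiro.coeffPos α β' π n j)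
          (nhdsWithin β {β}ᶜ) (nhds (b π n j))) ∧
      -- the recurrence relation of the type II polynomials
      (∀ (π : Equiv.Perm (Fin p)) (n : Fin p → ℕ) (k : Fin p),
        (∀ i j : Fin p, i < j → n (π j) ≠ 0 → n (π i) ≠ 0) →
        Polynomial.X * JacobiPineiro.typeII α β n =
          JacobiPineiro.typeII α β (n + Pi.single k 1) +
          Polynomial.C (JacobiPineiro.coeffZero α β n k) * JacobiPineiro.typeII α β n +
          ∑ j ∈ Finset.Icc 1 p, Polynomial.C (b π n j) *
            JacobiPineiro.typeIISub α β n (JacobiPineiro.stepIndex π j)) ∧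
      -- the recurrence relation of the type I polynomials
      (∀ (π : Equiv.Perm (Fin p)) (n : Fin p → ℕ) (k : Fin p), 1 ≤ n k → ∀ i : Fin p,
        Polynomial.X * JacobiPineiro.typeI α β n i =
          JacobiPineiro.typeI α β (n - Pi.single k 1) i +
          Polynomial.C (JacobiPineiro.coeffZero α β (n - Pi.single k 1) k) *
            JacobiPineiro.typeI α β n i +
          ∑ j ∈ Finset.Icc 1 p,
            Polynomial.C (b π (n + JacobiPineiro.stepIndex π (j - 1)) j) *
              JacobiPineiro.typeI α β (n + JacobiPineiro.stepIndex π j) i) := by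
  refine ⟨JacobiPineiro.isTypeII_iff hα hβ hαα, JacobiPineiro.isTypeI_iff hα hβ hαα,
    -- If `s_{j-1} ≤ n` fails, the truncated difference gives a meaningless value, but then `s_j ≤
    -- n` fails too and `typeIISub` is zero.
    fun π n j => JacobiPineiro.typeIForm α β (n - JacobiPineiro.stepIndex π (j - 1))
      (Polynomial.X * JacobiPineiro.typeII α β n), fun π n j hj hjp hn hjn =>
        JacobiPineiro.closedForm hα hβ hαα π n hj hjp hn hjn, fun π n k hn => ?_,
    fun π n k hk i => ?_⟩
  · rw [← JacobiPineiro.typeIForm_add_single hα hβ hαα]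
    exact JacobiPineiro.typeII_recurrence hα hβ hαα π n k hn
  · have hle : Pi.single k 1 ≤ n := by
      intro q
      by_cases hq : q = k
      · subst hq; simpa using hk
      · simp [hq]
    rw [← JacobiPineiro.typeIForm_add_single hα hβ hαα, tsub_add_cancel_of_le hle]
    -- At the index `n + s_{j-1}` the subtraction inside `b` is exact, so the type I vector in the
    -- pairing is always that of `n`.
    simp only [add_tsub_cancel_right]
    exact JacobiPineiro.typeI_recurrence hα hβ hαα π n k hk i
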